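/- **Setting.** Let $q\in\mathbb C^{*}$ and let $\mathbb C_q$ be the quantum torus with basis $x^{a}y^{b}$, $(a,b)\in\mathbb Z^2$, and $yx=q\,xy$. For $m=(m_1,m_2)\in\mathbb Z^2$ and $k\in\mathbb Z^2\setminus\{0\}$ put $e_m=E_{12}x^{m_1}y^{m_2}$, $f_m=E_{21}x^{m_1}y^{m_2}$, $d=E_{11}-E_{22}$, $g_k=E_{11}x^{k_1}y^{k_2}$, $h_k=E_{22}x^{k_1}y^{k_2}$, and $g_0=h_0=0$. These elements (with $k\neq0$) form a basis of a Lie algebra $L$ of $2\times2$ matrices over $\mathbb C_q$ under the commutator. Let $\widehat{\mathfrak{sl}}_2(\mathbb C_q)=L\oplus\mathbb C d_1\oplus\mathbb C d_2$, where $[d_i,z]=m_iz$ for $z\in L$ of degree $m=(m_1,m_2)$ and $[d_1,d_2]=0$, and let $U$ be its universal enveloping algebra. A Hopf algebra structure on $U[[t]]$ over $\mathbb C[[t]]$ is understood in the topological sense: the coproduct $\Delta$ is a homomorphism of $\mathbb C[[t]]$-algebras from $U[[t]]$ to the $t$-adically completed tensor square $U[[t]]\,\widehat\otimes\,U[[t]]=(U\otimes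 U)[[t]]$, the counit is a homomorphism of $\mathbb C[[t]]$-algebras $U[[t]]\to\mathbb C[[t]]$, the antipode $S$ is $\mathbb C[[t]]$-linear, and the usual axioms hold in the completed tensor powers. For $j\ge0$, $a\in\mathbb C$ put $T_a^{<j>}=(T+a)(T+a+1)\cdots(T+a+j-1)$ (equal to $1$ for $j=0$), $T^{<j>}=T_0^{<j>}$, $T_1=T_1^{<1>}=T+1$, and $(1-Et)^r=\sum_{j\ge0}\binom rj(-E)^jt^j$ for $r\in\mathbb C$. For fixed $n=(n_1,n_2)\in\mathbb Z^2$ put $\eta^y_{0,m}=1$ and, for $j\geq1$, $$\eta^g_{j,m}=0,\quad \eta^h_{j,m}=(-1)^j\prod_{p=1}^{j}\bigl(q^{n_2(m_1+(p-1)n_1)}-q^{n_1(m_2+(p-1)n_2)}\bigr),\quad \eta^e_{j,m}=\prod_{p=1}^{j}q^{n_1(m_2+(p-1)n_2)},\quad \eta^f_{j,m}=(-1)^j\prod_{p=1}^{j}q^{n_2(m_1+(p-1)n_1)};$$ $\beta_{f_m}=0$, $\beta_{g_m}=-q^{m_1n_2}$, $\beta_{h_m}=q^{m_2n_1}$; $s_m=q^{n_2m_1+n_1m_2+n_1n_2}$;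 $\delta_{f,f}=1$ and $\delta_{g,f}=\delta_{h,f}=0$. In $y_m$ the index $m$ runs over $\mathbb Z^2$ if $y\in\{e,f\}$ and over $\mathbb Z^2\setminus\{0\}$ if $y\in\{g,h\}$. **Statement.** In each of the following three cases there is a noncommutative and noncocommutative Hopf algebra structure on $U[[t]]$ over $\mathbb C[[t]]$, with the product, unit and counit of $U[[t]]$ unchanged, whose coproduct $\Delta$ and antipode $S$ satisfy the following formulas, for $i=1,2$ and all $m$ as above. (1) $T=x_1d_1+x_2d_2$ with $x_1,x_2\in\mathbb C$, $E=h_n$ with $n\ne0$, $[T,E]=E$, $r=x_1m_1+x_2m_2$, $y\in\{e,f,g,h\}$: $$\Delta(y_m)=y_m\otimes(1-Et)^r+\sum_{j\ge0}\frac{\eta^y_{j,m}}{j!}T^{<j>}\otimes(1-Et)^{-j}y_{m+jn}t^j,$$ $$S(y_m)=\sum_{j\ge0}\frac{(-1)^{j+1}\eta^y_{j,m}}{j!}(1-Et)^{-r}y_{m+jn}T_1^{<j>}t^j,$$ $$\Delta(d_i)=d_i\otimes1+1\otimes d_i-n_iT\otimes1+n_iT\otimes(1-Et)^{-1},\qquad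 S(d_i)=-d_i+n_iTEt,$$ $$\Delta(d)=d\otimes1+1\otimes d,\qquad S(d)=-d.$$ (2) $T=x_1d_1+x_2d_2$ with $x_1,x_2\in\mathbb C$, $E=f_n$, $[T,E]=E$, $r=x_1m_1+x_2m_2$, $y\in\{f,g,h\}$: $$\Delta(y_m)=y_m\otimes(1-Et)^r+1\otimes y_m+\beta_{y_m}T\otimes(1-Et)^{-1}f_{m+n}t,$$ $$S(y_m)=-(1-Et)^{-r}y_m+\beta_{y_m}(1-Et)^{-r}f_{m+n}T_1t;$$ for $m+n\ne0$ $$\Delta(e_m)=q^{m_2n_1}T\otimes(1-Et)^{-1}g_{m+n}t-q^{m_1n_2}T\otimes(1-Et)^{-1}h_{m+n}t+e_m\otimes(1-Et)^r+1\otimes e_m-s_mT^{<2>}\otimes(1-Et)^{-2}f_{m+2n}t^2,$$ $$S(e_m)=q^{m_2n_1}(1-Et)^{-r}g_{m+n}T_1t-q^{m_1n_2}(1-Et)^{-r}h_{m+n}T_1t-(1-Et)^{-r}e_m+s_m(1-Et)^{-r}f_{m+2n}T_1^{<2>}t^2;$$ $$\Delta(e_{-n})=e_{-n}\otimes(1-Et)^{-1}+1\otimes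 e_{-n}+q^{-n_1n_2}T\otimes(1-Et)^{-1}dt-q^{-n_1n_2}T^{<2>}\otimes(1-Et)^{-2}Et^2,$$ $$S(e_{-n})=q^{-n_1n_2}(1-Et)ET_1^{<2>}t^2-(1-Et)e_{-n}+q^{-n_1n_2}(1-Et)dT_1t;$$ $$\Delta(d)=d\otimes1+1\otimes d-2T\otimes(1-Et)^{-1}Et,\qquad S(d)=-d-2ET_1t,$$ $$\Delta(d_i)=d_i\otimes1+1\otimes d_i-n_iT\otimes1+n_iT\otimes(1-Et)^{-1},\qquad S(d_i)=-d_i+n_iTEt.$$ (3) $T=-\tfrac12d$, $E=f_n$ with $n\in\mathbb Z^2$ arbitrary, $y\in\{f,g,h\}$: $$\Delta(y_m)=y_m\otimes(1-Et)^{\delta_{y,f}}+1\otimes y_m+\beta_{y_m}T\otimes(1-Et)^{-1}f_{m+n}t,$$ $$S(y_m)=-(1-Et)^{-\delta_{y,f}}y_m+\beta_{y_m}f_{m+n}T_1t;$$ for $m+n\ne0$ $$\Delta(e_m)=q^{m_2n_1}T\otimes(1-Et)^{-1}g_{m+n}t-q^{m_1n_2}T\otimes(1-Et)^{-1}h_{m+n}t+e_m\otimes(1-Et)^{-1}+1\otimes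 e_m-s_mT^{<2>}\otimes(1-Et)^{-2}f_{m+2n}t^2,$$ $$S(e_m)=q^{m_2n_1}(1-Et)g_{m+n}T_1t-q^{m_1n_2}(1-Et)T_1h_{m+n}t-(1-Et)e_m+s_m(1-Et)f_{m+2n}T_1^{<2>}t^2;$$ $$\Delta(e_{-n})=e_{-n}\otimes(1-Et)^{-1}+q^{-n_1n_2}T\otimes(1-Et)^{-1}dt+1\otimes e_{-n}-q^{-n_1n_2}T^{<2>}\otimes(1-Et)^{-2}Et^2,$$ $$S(e_{-n})=q^{-n_1n_2}(1-Et)ET_1^{<2>}t^2-(1-Et)e_{-n}+q^{-n_1n_2}(1-Et)dT_1t;$$ $$\Delta(d)=d\otimes1+1\otimes d-2T\otimes(1-Et)^{-1}Et,\qquad S(d)=-d-2ET_1t,$$ $$\Delta(d_i)=d_i\otimes1+1\otimes d_i+n_iT\otimes(1-Et)^{-1}-n_iT\otimes1,\qquad S(d_i)=-d_i+n_iTEt.$$ -/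

import Mathlib

open PowerSeries TensorProduct

noncomputable section

namespace EALA

/-! ### The quantum torus -/

/-- The quantum torus `ℂ_q = ℂ_q[x^{±1}, y^{±1}]`, `y x = q x y`, as the vector space on the monomials
`x^{m 0} y^{m 1}`, `m ∈ ℤ²`. -/
def QTorus (_q : ℂˣ) : Type := (Fin 2 → ℤ) →₀ ℂ

namespace QTorus

variable (q : ℂˣ)

instance : AddCommGroup (QTorus q) := inferInstanceAs (AddCommGroup ((Fin 2 → ℤ) →₀ ℂ))

instance : Module ℂ (QTorus q) := inferInstanceAs (Module ℂ ((Fin 2 → ℤ) →₀ ℂ))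

/-- The monomial `x^{m 0} y^{m 1}`. -/
def mono (m : Fin 2 → ℤ) : QTorus q := Finsupp.single m (1 : ℂ)

/-- The linear map on the quantum torus with given values on the monomials. -/
def lin {M : Type*} [AddCommGroup M] [Module ℂ M] (v : (Fin 2 → ℤ) → M) : QTorus q →ₗ[ℂ] M :=
  Finsupp.linearCombination ℂ v

/-- The coefficient at the monomial `1`. -/
def coeffZero : QTorus q →ₗ[ℂ] ℂ := lin q (fun m => if m = 0 then 1 else 0)

/-- The product, `(x^{m 0} y^{m 1}) (x^{m' 0} y^{m' 1}) = q^{m 1 * m' 0} x^{m 0 + m' 0} y^{m 1 + m' 1}`. -/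
def mulLin : QTorus q →ₗ[ℂ] QTorus q →ₗ[ℂ] QTorus q :=
  lin q (fun m => lin q (fun m' => ((q ^ (m 1 * m' 0) : ℂˣ) : ℂ) • mono q (m + m')))

variable {q}

theorem lin_mono {M : Type*} [AddCommGroup M] [Module ℂ M] (v : (Fin 2 → ℤ) → M)
    (m : Fin 2 → ℤ) : lin q v (mono q m) = v m := by
  unfold lin mono
  exact (Finsupp.linearCombination_single ℂ (1 : ℂ) m).trans (one_smul ℂ _)

theorem lin_ext {M : Type*} [AddCommGroup M] [Module ℂ M] {f g : QTorus q →ₗ[ℂ] M}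
    (h : ∀ m, f (mono q m) = g (mono q m)) : f = g :=
  Finsupp.lhom_ext' (M := ℂ) (N := M) fun m => LinearMap.ext_ring (h m)

theorem mulLin_mono (m m' : Fin 2 → ℤ) :
    mulLin q (mono q m) (mono q m') = ((q ^ (m 1 * m' 0) : ℂˣ) : ℂ) • mono q (m + m') := by
  rw [mulLin, lin_mono, lin_mono]

theorem mulLin_assoc (a b c : QTorus q) :
    mulLin q (mulLin q a b) c = mulLin q a (mulLin q b c) := by
  have h : (mulLin q).compr₂ (mulLin q) =
      ((LinearMap.llcomp ℂ (QTorus q) (QTorus q) (QTorus q)).flip ∘ₗ (mulLin q)).flip ∘ₗ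
        (mulLin q) := by
    refine lin_ext fun m => lin_ext fun m' => lin_ext fun m'' => ?_
    simp only [LinearMap.compr₂_apply, LinearMap.comp_apply, LinearMap.flip_apply,
      LinearMap.llcomp_apply, mulLin_mono, map_smul, LinearMap.smul_apply, smul_smul, add_assoc]
    congr 1
    rw [← Units.val_mul, ← Units.val_mul, ← zpow_add, ← zpow_add]
    congr 2
    simp only [Pi.add_apply]
    ring
  exact LinearMap.congr_fun (LinearMap.congr_fun (LinearMap.congr_fun h a) b) c

theorem mulLin_one_left (a : QTorus q) : mulLin q (mono q 0) a = a := by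
  have h : mulLin q (mono q 0) = LinearMap.id := by
    refine lin_ext fun m => ?_
    simp [mulLin_mono]
  exact LinearMap.congr_fun h a

theorem mulLin_one_right (a : QTorus q) : mulLin q a (mono q 0) = a := by
  have h : (mulLin q).flip (mono q 0) = LinearMap.id := by
    refine lin_ext fun m => ?_
    simp [mulLin_mono]
  exact LinearMap.congr_fun h a

instance : Ring (QTorus q) where
  __ := (inferInstance : AddCommGroup (QTorus q))
  mul a b := mulLin q a b
  one := mono q 0
  left_distrib a b c := map_add (mulLin q a) b c
  right_distrib a b c := LinearMap.map_add₂ (mulLin q) a b c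
  zero_mul a := LinearMap.map_zero₂ (mulLin q) a
  mul_zero a := map_zero (mulLin q a)
  mul_assoc := mulLin_assoc
  one_mul := mulLin_one_left
  mul_one := mulLin_one_right

theorem mul_def (a b : QTorus q) : a * b = mulLin q a b := rfl

theorem one_def : (1 : QTorus q) = mono q 0 := rfl

instance : Algebra ℂ (QTorus q) :=
  Algebra.ofModule (fun r a b => LinearMap.map_smul₂ (mulLin q) r a b)
    (fun r a b => map_smul (mulLin q a) r b)

theorem coeffZero_mul_comm (a b : QTorus q) : coeffZero q (a * b) = coeffZero q (b * a) := by
  have h : (mulLin q).compr₂ (coeffZero q) = ((mulLin q).compr₂ (coeffZero q)).flip := by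
    refine lin_ext fun m => lin_ext fun m' => ?_
    simp only [LinearMap.compr₂_apply, LinearMap.flip_apply, mulLin_mono, map_smul, coeffZero,
      lin_mono, add_comm m' m]
    by_cases hm : m + m' = 0
    · have h0 := congrFun hm 0
      have h1 := congrFun hm 1
      simp only [Pi.add_apply, Pi.zero_apply] at h0 h1
      have e : m 1 * m' 0 = m' 1 * m 0 := by
        rw [eq_neg_of_add_eq_zero_left h1, eq_neg_of_add_eq_zero_right h0]; ring
      rw [e]
    · simp [hm]
  exact LinearMap.congr_fun (LinearMap.congr_fun h a) b

variable (q) in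
/-- The degree derivation `x^{m 0} y^{m 1} ↦ (a 0 * m 0 + a 1 * m 1) x^{m 0} y^{m 1}`. -/
def deg (a : Fin 2 → ℂ) : QTorus q →ₗ[ℂ] QTorus q :=
  lin q (fun m => (∑ i, a i * (m i : ℂ)) • mono q m)

theorem deg_mul (a : Fin 2 → ℂ) (u v : QTorus q) :
    deg q a (u * v) = deg q a u * v + u * deg q a v := by
  have h : (mulLin q).compr₂ (deg q a) =
      (mulLin q) ∘ₗ (deg q a) + ((mulLin q).flip ∘ₗ (deg q a)).flip := by
    refine lin_ext fun m => lin_ext fun m' => ?_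
    simp only [LinearMap.compr₂_apply, LinearMap.add_apply, LinearMap.comp_apply,
      LinearMap.flip_apply, deg, lin_mono, map_smul, LinearMap.smul_apply, mulLin_mono, smul_smul,
      ← add_smul]
    congr 1
    simp only [Fin.sum_univ_two, Pi.add_apply]
    push_cast
    ring
  exact LinearMap.congr_fun (LinearMap.congr_fun h u) v

theorem coeffZero_deg (a : Fin 2 → ℂ) (u : QTorus q) : coeffZero q (deg q a u) = 0 := by
  have h : coeffZero q ∘ₗ deg q a = 0 := by
    refine lin_ext fun m => ?_
    by_cases hm : m = 0 <;> simp [coeffZero, deg, lin_mono, hm]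
  exact LinearMap.congr_fun h u

theorem deg_comm (a b : Fin 2 → ℂ) (u : QTorus q) :
    deg q a (deg q b u) = deg q b (deg q a u) := by
  have h : deg q a ∘ₗ deg q b = deg q b ∘ₗ deg q a := by
    refine lin_ext fun m => ?_
    simp only [LinearMap.comp_apply, deg, lin_mono, map_smul, smul_smul]
    rw [mul_comm]
  exact LinearMap.congr_fun h u

theorem deg_add (a b : Fin 2 → ℂ) : deg q (a + b) = deg q a + deg q b := by
  refine lin_ext fun m => ?_
  simp [deg, lin_mono, ← add_smul, add_mul, Finset.sum_add_distrib]

theorem deg_smul (c : ℂ) (a : Fin 2 → ℂ) : deg q (c • a) = c • deg q a := by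
  refine lin_ext fun m => ?_
  simp only [deg, lin_mono, LinearMap.smul_apply, smul_smul, Finset.mul_sum, Pi.smul_apply,
    smul_eq_mul, mul_assoc]

end QTorus

/-! ### The extended affine Lie algebra -/

section Lie

attribute [local instance 100] LieRing.ofAssociativeRing

open QTorus

/-- The Lie algebra `sl₂(ℂ_q)`: the `2 × 2` matrices over `ℂ_q` whose trace has no constant term.
It has the basis `E₁₂ x^a y^b`, `E₂₁ x^a y^b`, `E₁₁ - E₂₂` and `E₁₁ x^a y^b`, `E₂₂ x^a y^b` with
`(a, b) ≠ (0, 0)`; the bracket is the commutator. -/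
def sl2 (q : ℂˣ) : LieSubalgebra ℂ (Matrix (Fin 2) (Fin 2) (QTorus q)) where
  carrier := {A | coeffZero q A.trace = 0}
  add_mem' := by
    intro A B hA hB
    simp only [Set.mem_ofPred_eq, Matrix.trace_add, map_add] at *
    rw [hA, hB, add_zero]
  zero_mem' := by simp
  smul_mem' := by
    intro c A hA
    simp only [Set.mem_ofPred_eq, Matrix.trace_smul, map_smul] at *
    rw [hA, smul_zero]
  lie_mem' := by
    intro A B _ _
    have e : coeffZero q (A * B).trace = coeffZero q (B * A).trace := by
      simp only [Matrix.trace, Matrix.diag, Matrix.mul_apply, Fin.sum_univ_two, map_add]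
      rw [coeffZero_mul_comm (A 0 0), coeffZero_mul_comm (A 0 1), coeffZero_mul_comm (A 1 0),
        coeffZero_mul_comm (A 1 1)]
      ring
    show coeffZero q (A * B - B * A).trace = 0
    rw [Matrix.trace_sub, map_sub, e, sub_self]

/-- The degree derivation `a 0 • d₁ + a 1 • d₂` of `sl₂(ℂ_q)`, acting on the entries. -/
def degDer (q : ℂˣ) (a : Fin 2 → ℂ) : LieDerivation ℂ (sl2 q) (sl2 q) where
  toFun A := ⟨A.1.map (deg q a), by
    show coeffZero q (A.1.map (deg q a)).trace = 0
    simp [Matrix.trace, coeffZero_deg]⟩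
  map_add' A B := by
    apply Subtype.ext; ext i j : 2
    exact map_add (deg q a) _ _
  map_smul' c A := by
    apply Subtype.ext; ext i j : 2
    exact map_smul (deg q a) c _
  leibniz' A B := by
    apply Subtype.ext; ext i j : 2
    show deg q a ((A.1 * B.1 - B.1 * A.1) i j) =
      (A.1 * B.1.map (deg q a) - B.1.map (deg q a) * A.1) i j -
        (B.1 * A.1.map (deg q a) - A.1.map (deg q a) * B.1) i j
    simp only [Matrix.sub_apply, Matrix.mul_apply, Matrix.map_apply, map_sub, map_sum, deg_mul,
      Finset.sum_add_distrib]
    abel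

/-- The action of the abelian Lie algebra `ℂ d₁ ⊕ ℂ d₂` on `sl₂(ℂ_q)`. -/
def degAction (q : ℂˣ) : (Fin 2 → ℂ) →ₗ⁅ℂ⁆ LieDerivation ℂ (sl2 q) (sl2 q) where
  toFun := degDer q
  map_add' a b := by
    refine LieDerivation.ext fun A => Subtype.ext ?_
    ext i j : 2
    exact LinearMap.congr_fun (deg_add a b) (A.1 i j)
  map_smul' c a := by
    refine LieDerivation.ext fun A => Subtype.ext ?_
    ext i j : 2
    exact LinearMap.congr_fun (deg_smul c a) (A.1 i j)
  map_lie' := by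
    intro a b
    refine LieDerivation.ext fun A => Subtype.ext ?_
    rw [LieDerivation.lie_apply]
    ext i j : 2
    have h0 : ⁅a, b⁆ = (0 : ℂ) • a := by
      rw [zero_smul]; funext i; exact sub_eq_zero.mpr (mul_comm _ _)
    rw [h0]
    show deg q ((0 : ℂ) • a) (A.1 i j) =
      deg q a (deg q b (A.1 i j)) - deg q b (deg q a (A.1 i j))
    rw [deg_comm a b, sub_self, deg_smul, zero_smul, LinearMap.zero_apply]

/-- The extended affine Lie algebra `sl₂(ℂ_q) ⊕ ℂ d₁ ⊕ ℂ d₂`. -/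
abbrev ESL (q : ℂˣ) : Type := LieAlgebra.SemiDirectSum (sl2 q) (Fin 2 → ℂ) (degAction q)

/-- The element of the extended affine Lie algebra given by a matrix in `sl₂(ℂ_q)`. -/
def ofMatrix (q : ℂˣ) (A : Matrix (Fin 2) (Fin 2) (QTorus q)) (hA : coeffZero q A.trace = 0) :
    ESL q := ⟨⟨A, hA⟩, 0⟩

/-- `e_m = E₁₂ x^{m 0} y^{m 1}`. -/
def e (q : ℂˣ) (m : Fin 2 → ℤ) : ESL q :=
  ofMatrix q !![0, mono q m; 0, 0] (by simp [Matrix.trace])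

/-- `f_m = E₂₁ x^{m 0} y^{m 1}`. -/
def f (q : ℂˣ) (m : Fin 2 → ℤ) : ESL q :=
  ofMatrix q !![0, 0; mono q m, 0] (by simp [Matrix.trace])

/-- `g_m = E₁₁ x^{m 0} y^{m 1}` for `m ≠ 0`, and `g_0 = 0`. -/
def g (q : ℂˣ) (m : Fin 2 → ℤ) : ESL q :=
  if hm : m = 0 then 0 else
    ofMatrix q !![mono q m, 0; 0, 0] (by simp [Matrix.trace, coeffZero, lin_mono, hm])

/-- `h_m = E₂₂ x^{m 0} y^{m 1}` for `m ≠ 0`, and `h_0 = 0`. -/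
def h (q : ℂˣ) (m : Fin 2 → ℤ) : ESL q :=
  if hm : m = 0 then 0 else
    ofMatrix q !![0, 0; 0, mono q m] (by simp [Matrix.trace, coeffZero, lin_mono, hm])

/-- `d = E₁₁ - E₂₂`. -/
def d (q : ℂˣ) : ESL q := ofMatrix q !![1, 0; 0, -1] (by simp [Matrix.trace])

/-- The degree derivations `d₁ = dd q 0` and `d₂ = dd q 1`. -/
def dd (q : ℂˣ) (i : Fin 2) : ESL q := ⟨0, Pi.single i 1⟩

/-- The universal enveloping algebra. -/
abbrev U (q : ℂˣ) : Type := UniversalEnvelopingAlgebra ℂ (ESL q)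

/-- The canonical map from the Lie algebra to its universal enveloping algebra. -/
def toU {q : ℂˣ} (z : ESL q) : U q := UniversalEnvelopingAlgebra.ι ℂ z

/-- The counit of the universal enveloping algebra: it kills the Lie algebra. -/
def counitU (q : ℂˣ) : U q →ₐ[ℂ] ℂ := UniversalEnvelopingAlgebra.lift ℂ (0 : ESL q →ₗ⁅ℂ⁆ ℂ)

end Lie

/-! ### Formal (`t`-adically completed) Hopf algebras

For a `k`-algebra `A`, the completed tensor powers over `k⟦t⟧` of `A⟦t⟧` are `(A ⊗ A)⟦t⟧`,
`(A ⊗ (A ⊗ A))⟦t⟧`, and so on. The formal variable `t` is `PowerSeries.X`. -/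

section Formal

variable (k : Type*) [CommRing k]

/-- The structure map `k⟦t⟧ → A⟦t⟧` of the `k⟦t⟧`-algebra `A⟦t⟧`. -/
def scalar (A : Type*) [Ring A] [Algebra k A] : k⟦X⟧ →+* A⟦X⟧ := PowerSeries.map (algebraMap k A)

variable {k}
variable {A B : Type*} [Ring A] [Algebra k A] [Ring B] [Algebra k B]

/-- The coefficientwise extension of a linear map `A → B` to `A⟦t⟧ → B⟦t⟧`. -/
def mapCoeff (φ : A →ₗ[k] B) (z : A⟦X⟧) : B⟦X⟧ := PowerSeries.mk fun N => φ (coeff N z)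

/-- The components `F_i : A → B` of a map `F : A⟦t⟧ → B⟦t⟧`, so that `F a = ∑ i, F_i a t^i` for
`a ∈ A`. A `k⟦t⟧`-linear `F` is determined by them. -/
def component (F : A⟦X⟧ →ₗ[k] B⟦X⟧) (i : ℕ) : A →ₗ[k] B where
  toFun a := coeff i (F (C a))
  map_add' a b := by simp
  map_smul' c a := by
    have e : (C (c • a) : A⟦X⟧) = c • C a := by
      ext N; rw [PowerSeries.coeff_C]; change _ = c • coeff N (C a)
      rw [PowerSeries.coeff_C]; split_ifs <;> simp
    rw [e, map_smul]; rfl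

/-- The completed tensor product `F ⊗̂ id : (A ⊗ D)⟦t⟧ → (B ⊗ D)⟦t⟧` of a `k⟦t⟧`-linear map
`F : A⟦t⟧ → B⟦t⟧` with the identity of `D⟦t⟧`. -/
def rTens (D : Type*) [Ring D] [Algebra k D] (F : A⟦X⟧ →ₗ[k] B⟦X⟧) (z : (A ⊗[k] D)⟦X⟧) :
    (B ⊗[k] D)⟦X⟧ :=
  PowerSeries.mk fun N =>
    ∑ p ∈ Finset.HasAntidiagonal.antidiagonal N, (component F p.1).rTensor D (coeff p.2 z)

/-- The completed tensor product `id ⊗̂ F : (D ⊗ A)⟦t⟧ → (D ⊗ B)⟦t⟧` of the identity of `D⟦t⟧` with a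
`k⟦t⟧`-linear map `F : A⟦t⟧ → B⟦t⟧`. -/
def lTens (D : Type*) [Ring D] [Algebra k D] (F : A⟦X⟧ →ₗ[k] B⟦X⟧) (z : (D ⊗[k] A)⟦X⟧) :
    (D ⊗[k] B)⟦X⟧ :=
  PowerSeries.mk fun N =>
    ∑ p ∈ Finset.HasAntidiagonal.antidiagonal N, (component F p.1).lTensor D (coeff p.2 z)

variable (k A) in
/-- A (topological) Hopf algebra structure over `k⟦t⟧` on the `k⟦t⟧`-algebra `A⟦t⟧`, with its usual
product and unit. The comultiplication takes values in the completed tensor square `(A ⊗ A)⟦t⟧`;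
comultiplication and counit are homomorphisms of `k⟦t⟧`-algebras, the antipode is `k⟦t⟧`-linear. -/
structure FormalHopf where
  comul : A⟦X⟧ →ₐ[k] (A ⊗[k] A)⟦X⟧
  counit : A⟦X⟧ →ₐ[k] k⟦X⟧
  antipode : A⟦X⟧ →ₗ[k] A⟦X⟧
  comul_scalar : ∀ c : k⟦X⟧, comul (scalar k A c) = scalar k (A ⊗[k] A) c
  counit_scalar : ∀ c : k⟦X⟧, counit (scalar k A c) = c
  antipode_scalar : ∀ (c : k⟦X⟧) (a : A⟦X⟧), antipode (scalar k A c * a) = scalar k A c * antipode a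
  coassoc : ∀ a : A⟦X⟧,
    mapCoeff (TensorProduct.assoc k A A A).toLinearMap (rTens A comul.toLinearMap (comul a)) =
      lTens A comul.toLinearMap (comul a)
  counit_left : ∀ a : A⟦X⟧,
    mapCoeff (TensorProduct.lid k A).toLinearMap (rTens A counit.toLinearMap (comul a)) = a
  counit_right : ∀ a : A⟦X⟧,
    mapCoeff (TensorProduct.rid k A).toLinearMap (lTens A counit.toLinearMap (comul a)) = a
  antipode_left : ∀ a : A⟦X⟧,
    mapCoeff (LinearMap.mul' k A) (rTens A antipode (comul a)) = scalar k A (counit a)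
  antipode_right : ∀ a : A⟦X⟧,
    mapCoeff (LinearMap.mul' k A) (lTens A antipode (comul a)) = scalar k A (counit a)

/-- The product of `A⟦t⟧` is not commutative. -/
def FormalHopf.Noncommutative (_H : FormalHopf k A) : Prop := ∃ a b : A⟦X⟧, a * b ≠ b * a

/-- The coproduct is not invariant under the flip of the two tensor factors. -/
def FormalHopf.Noncocommutative (H : FormalHopf k A) : Prop :=
  ∃ a : A⟦X⟧, mapCoeff (TensorProduct.comm k A A).toLinearMap (H.comul a) ≠ H.comul a

variable (k) in
/-- The completed tensor `u ⊗̂ v = (u ⊗̂ 1) (1 ⊗̂ v)` of two power series, with coefficients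
`∑_{i + j = N} u_i ⊗ v_j`. -/
def tens (u v : A⟦X⟧) : (A ⊗[k] A)⟦X⟧ :=
  PowerSeries.map (Algebra.TensorProduct.includeLeft : A →ₐ[k] A ⊗[k] A).toRingHom u *
    PowerSeries.map (Algebra.TensorProduct.includeRight : A →ₐ[k] A ⊗[k] A).toRingHom v

/-- The `t`-adically convergent sum `∑_j F_j t^j` of a sequence of power series `F_j`. -/
def tSum (F : ℕ → A⟦X⟧) : A⟦X⟧ :=
  PowerSeries.mk fun N => ∑ p ∈ Finset.HasAntidiagonal.antidiagonal N, coeff p.2 (F p.1)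

end Formal

section Expressions

variable {A : Type*} [Ring A] [Algebra ℂ A]

/-- The binomial series `(1 - E t)^r = ∑_j r (r - 1) ⋯ (r - j + 1) / j! (-E)^j t^j`, `r ∈ ℂ`. -/
def oneSubPow (E : A) (r : ℂ) : A⟦X⟧ :=
  PowerSeries.mk fun j => ((∏ i ∈ Finset.range j, (r - (i : ℂ))) / (j.factorial : ℂ)) • (-E) ^ j

/-- The rising factorial `T_a^{<j>} = (T + a) (T + a + 1) ⋯ (T + a + j - 1)`. -/
def rise (T : A) (a : ℂ) : ℕ → A
  | 0 => 1
  | j + 1 => rise T a j * (T + algebraMap ℂ A (a + (j : ℂ)))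

variable {q : ℂˣ}

/-- An element of the Lie algebra as a constant power series over the enveloping algebra. -/
def emb (z : ESL q) : (U q)⟦X⟧ := C (toU z)

/-- The series `(1 - E t)^r` for an element `E` of the Lie algebra. -/
def pw (E : ESL q) (r : ℂ) : (U q)⟦X⟧ := oneSubPow (toU E) r

/-- The completed tensor of two elements of `U⟦t⟧`. -/
def ot (u v : (U q)⟦X⟧) : (U q ⊗[ℂ] U q)⟦X⟧ := tens ℂ u v

end Expressions

/-- The four families of root and imaginary vectors. -/
inductive Letter
  | e | f | g | h

/-- `y_m` for `y = e, f, g, h`. -/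
def Letter.elt (q : ℂˣ) : Letter → (Fin 2 → ℤ) → ESL q
  | .e => EALA.e q
  | .f => EALA.f q
  | .g => EALA.g q
  | .h => EALA.h q

/-- The indices `m` of the basis vectors `y_m`: all of `ℤ²` for `y = e, f`, and `m ≠ 0` for
`y = g, h`. -/
def Letter.Index : Letter → (Fin 2 → ℤ) → Prop
  | .e, _ => True
  | .f, _ => True
  | .g, m => m ≠ 0
  | .h, m => m ≠ 0

/-- The power `q^a`, as a complex number. -/
def qp (q : ℂˣ) (a : ℤ) : ℂ := ((q ^ a : ℂˣ) : ℂ)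

/-- The coefficients `η_{j,m}^y` (for a fixed `n`); the index `p` runs from `0` to `j - 1`. -/
def eta (q : ℂˣ) (n m : Fin 2 → ℤ) : Letter → ℕ → ℂ
  | .g, 0 => 1
  | .g, _ + 1 => 0
  | .h, j => (-1) ^ j * ∏ p ∈ Finset.range j,
      (qp q (n 1 * (m 0 + p * n 0)) - qp q (n 0 * (m 1 + p * n 1)))
  | .e, j => ∏ p ∈ Finset.range j, qp q (n 0 * (m 1 + p * n 1))
  | .f, j => (-1) ^ j * ∏ p ∈ Finset.range j, qp q (n 1 * (m 0 + p * n 0))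

/-- The coefficients `β_{y_m}` for `y = f, g, h` (for a fixed `n`); not used for `y = e`. -/
def beta (q : ℂˣ) (n m : Fin 2 → ℤ) : Letter → ℂ
  | .e => 0
  | .f => 0
  | .g => -qp q (m 0 * n 1)
  | .h => qp q (m 1 * n 0)

/-- The exponent `δ_{y,f}`. -/
def deltaF : Letter → ℂ
  | .f => 1
  | _ => 0

/-- `s_m = q^{n₂ m₁ + n₁ m₂ + n₁ n₂}` (for a fixed `n`). -/
def sCoef (q : ℂˣ) (n m : Fin 2 → ℤ) : ℂ := qp q (n 1 * m 0 + n 0 * m 1 + n 0 * n 1)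

end EALA

end

infix:68 " ⊠ " => EALA.ot

open EALA

/-!
For `[T, E] = E` the series `F = (1 - 1 ⊗ E t)^{T ⊗ 1}` is a Drinfeld twist of `U⟦t⟧`: moving a
function of `T` past `E` shifts its argument by `1`, so that the Taylor expansion of a power of
`1 - (1 ⊗ E + E ⊗ 1) t` around `1 - 1 ⊗ E t` gives the 2-cocycle condition. The twisted coproduct
of a primitive `y` with `[T, y] = r y` is `F (y ⊗ 1 + 1 ⊗ y) F⁻¹`, where conjugation multiplies
`y ⊗ 1` by `1 ⊗ (1 - E t)^r` and turns `1 ⊗ y` into a series in the iterated brackets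
`(ad E)^j y`. These are explicit multiples of basis elements for `E = h_n`, and vanish for `j ≥ 3`
when `E = f_n`. The twisted coproduct of `T` has the first-order term `T ⊗ E`, which is not
symmetric.
-/

noncomputable section

namespace EALA

open Finset.HasAntidiagonal (antidiagonal mem_antidiagonal)

attribute [local instance 100] LieRing.ofAssociativeRing

/-! ### Maps of power series that commute with the variable -/

section XLinear

variable {A B D : Type*} [Ring A] [Ring B] [Ring D]

/-- Additive maps of power series that commute with multiplication by the variable. This is what
is left of `k⟦t⟧`-linearity when the coefficient rings are not commutative; such maps are
determined by their values on the constants. -/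
@[fun_prop]
structure IsXLinear (Φ : A⟦X⟧ → B⟦X⟧) : Prop where
  add : ∀ u v, Φ (u + v) = Φ u + Φ v
  mul_X : ∀ u, Φ (u * X) = Φ u * X

namespace IsXLinear

@[fun_prop]
theorem comp {Φ : B⟦X⟧ → D⟦X⟧} {Ψ : A⟦X⟧ → B⟦X⟧} (hΦ : IsXLinear Φ) (hΨ : IsXLinear Ψ) :
    IsXLinear fun z => Φ (Ψ z) where
  add u v := by rw [hΨ.add, hΦ.add]
  mul_X u := by rw [hΨ.mul_X, hΦ.mul_X]

@[fun_prop]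
theorem mul_left (K : A⟦X⟧) : IsXLinear fun z => K * z where
  add u v := mul_add K u v
  mul_X u := (mul_assoc K u X).symm

@[fun_prop]
theorem mul_right (K : A⟦X⟧) : IsXLinear fun z => z * K where
  add u v := add_mul u v K
  mul_X u := by rw [mul_assoc, (commute_X K).symm.eq, ← mul_assoc]

@[fun_prop]
theorem map (φ : A →+* B) : IsXLinear fun z => PowerSeries.map φ z where
  add u v := map_add _ u v
  mul_X u := by rw [map_mul, map_X]

theorem ext {Φ Ψ : A⟦X⟧ → B⟦X⟧} (z : A⟦X⟧) (hC : ∀ a, Φ (C a) = Ψ (C a))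
    (hΦ : IsXLinear Φ := by fun_prop) (hΨ : IsXLinear Ψ := by fun_prop) : Φ z = Ψ z := by
  ext N
  induction N generalizing z with
  | zero =>
    rw [eq_shift_mul_X_add_const z, hΦ.add, hΨ.add, hΦ.mul_X, hΨ.mul_X, hC]
    simp
  | succ N ih =>
    rw [eq_shift_mul_X_add_const z, hΦ.add, hΨ.add, hΦ.mul_X, hΨ.mul_X, hC, map_add, map_add,
      coeff_succ_mul_X, coeff_succ_mul_X, ih]

theorem ext_tmul {k : Type*} [CommRing k] [Algebra k A] [Algebra k B] {Φ Ψ : (A ⊗[k] B)⟦X⟧ → D⟦X⟧}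
    (z : (A ⊗[k] B)⟦X⟧) (hC : ∀ a b, Φ (C (a ⊗ₜ b)) = Ψ (C (a ⊗ₜ b)))
    (hΦ : IsXLinear Φ := by fun_prop) (hΨ : IsXLinear Ψ := by fun_prop) : Φ z = Ψ z := by
  refine IsXLinear.ext z (fun w => ?_) hΦ hΨ
  induction w using TensorProduct.induction_on with
  | zero =>
    have hΦ0 := hΦ.add 0 0
    have hΨ0 := hΨ.add 0 0
    rw [add_zero, left_eq_add] at hΦ0 hΨ0
    rw [map_zero, hΦ0, hΨ0]
  | tmul a b => exact hC a b
  | add u v hu hv => rw [map_add, hΦ.add, hΨ.add, hu, hv]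

end IsXLinear

variable {k : Type*} [CommRing k] [Algebra k A] [Algebra k B] [Algebra k D]

/-- The map `A⟦t⟧ → B⟦t⟧` that commutes with `t` and sends a constant `a` to `∑ i, ψ i a t^i`. -/
def extend (ψ : ℕ → A →ₗ[k] B) (z : A⟦X⟧) : B⟦X⟧ :=
  PowerSeries.mk fun N => ∑ p ∈ antidiagonal N, ψ p.1 (coeff p.2 z)

theorem isXLinear_extend (ψ : ℕ → A →ₗ[k] B) : IsXLinear (extend ψ) where
  add u v := by ext N; simp [extend, Finset.sum_add_distrib]
  mul_X u := by
    ext N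
    cases N with
    | zero => simp [extend]
    | succ N =>
      rw [coeff_succ_mul_X, extend, coeff_mk, Finset.Nat.sum_antidiagonal_succ', extend, coeff_mk]
      simp [coeff_succ_mul_X]

theorem coeff_extend_C (ψ : ℕ → A →ₗ[k] B) (a : A) (N : ℕ) : coeff N (extend ψ (C a)) = ψ N a := by
  rw [extend, coeff_mk, Finset.sum_eq_single (N, 0)]
  · simp
  · rintro ⟨i, j⟩ hij hne
    have hj : j ≠ 0 := by
      rintro rfl
      exact hne (by simpa using hij)
    rw [coeff_C, if_neg hj, map_zero]
  · simp

@[fun_prop]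
theorem isXLinear_rTens (F : A⟦X⟧ →ₗ[k] B⟦X⟧) : IsXLinear (rTens D F) :=
  isXLinear_extend fun i => (component F i).rTensor D

theorem coeff_rTens_C (F : A⟦X⟧ →ₗ[k] B⟦X⟧) (a : A) (b : D) (N : ℕ) :
    coeff N (rTens D F (C (a ⊗ₜ b))) = coeff N (F (C a)) ⊗ₜ b :=
  coeff_extend_C (fun i => (component F i).rTensor D) _ N

@[fun_prop]
theorem isXLinear_lTens (F : A⟦X⟧ →ₗ[k] B⟦X⟧) : IsXLinear (lTens D F) :=
  isXLinear_extend fun i => (component F i).lTensor D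

theorem coeff_lTens_C (F : A⟦X⟧ →ₗ[k] B⟦X⟧) (a : D) (b : A) (N : ℕ) :
    coeff N (lTens D F (C (a ⊗ₜ b))) = a ⊗ₜ coeff N (F (C b)) :=
  coeff_extend_C (fun i => (component F i).lTensor D) _ N

/-- The power series version of a bilinear map. -/
def bilin (β : A →ₗ[k] B →ₗ[k] D) (u : A⟦X⟧) : B⟦X⟧ → D⟦X⟧ := extend fun i => β (coeff i u)

@[fun_prop]
theorem isXLinear_bilin_right (β : A →ₗ[k] B →ₗ[k] D) (u : A⟦X⟧) : IsXLinear (bilin β u) :=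
  isXLinear_extend _

theorem bilin_flip (β : A →ₗ[k] B →ₗ[k] D) (u : A⟦X⟧) (v : B⟦X⟧) :
    bilin β.flip v u = bilin β u v := by
  ext N
  simp only [bilin, extend, coeff_mk, LinearMap.flip_apply]
  exact Finset.Nat.sum_antidiagonal_swap (f := fun p => β (coeff p.1 u) (coeff p.2 v))

@[fun_prop]
theorem isXLinear_bilin_left (β : A →ₗ[k] B →ₗ[k] D) (v : B⟦X⟧) :
    IsXLinear fun u => bilin β u v := by
  simp only [← bilin_flip β]
  fun_prop

theorem coeff_bilin_C (β : A →ₗ[k] B →ₗ[k] D) (u : A⟦X⟧) (b : B) (N : ℕ) :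
    coeff N (bilin β u (C b)) = β (coeff N u) b := coeff_extend_C _ b N

theorem bilin_C_C (β : A →ₗ[k] B →ₗ[k] D) (a : A) (b : B) :
    bilin β (C a) (C b) = C (β a b) := by
  ext N
  rw [coeff_bilin_C, coeff_C, coeff_C]
  split_ifs
  · rfl
  · rw [map_zero, LinearMap.zero_apply]

theorem mapCoeff_C (φ : A →ₗ[k] B) (a : A) : mapCoeff φ (C a) = C (φ a) := by
  ext N
  rw [mapCoeff, coeff_mk, coeff_C, coeff_C, apply_ite φ, map_zero]

@[fun_prop]
theorem isXLinear_mapCoeff (φ : A →ₗ[k] B) : IsXLinear (mapCoeff φ) where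
  add u v := by ext N; simp [mapCoeff]
  mul_X u := by ext N; cases N <;> simp [mapCoeff, coeff_succ_mul_X]

theorem mapAlgHom_C (φ : A →ₐ[k] B) (a : A) : mapAlgHom φ (C a) = C (φ a) := by
  rw [mapAlgHom_apply]
  exact map_C _ a

@[fun_prop]
theorem isXLinear_mapAlgHom (φ : A →ₐ[k] B) : IsXLinear (mapAlgHom φ) :=
  IsXLinear.map φ.toRingHom

theorem mapAlgHom_mapAlgHom (φ : B →ₐ[k] D) (ψ : A →ₐ[k] B) (z : A⟦X⟧) :
    mapAlgHom φ (mapAlgHom ψ z) = mapAlgHom (φ.comp ψ) z := rfl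

@[fun_prop]
theorem isXLinear_scalar : IsXLinear (scalar k A) := IsXLinear.map _

theorem scalar_C (r : k) : scalar k A (C r) = C (algebraMap k A r) := map_C _ r

theorem mapAlgHom_scalar (φ : A →ₐ[k] B) (c : k⟦X⟧) :
    mapAlgHom φ (scalar k A c) = scalar k B c := by
  apply IsXLinear.ext c
  intro r
  rw [scalar_C, mapAlgHom_C, scalar_C, AlgHom.commutes]

theorem scalar_commute (c : k⟦X⟧) (z : A⟦X⟧) : Commute (scalar k A c) z := by
  apply IsXLinear.ext c
  intro r
  apply IsXLinear.ext z
  intro a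
  rw [scalar_C, ← map_mul, ← map_mul, Algebra.commutes]

/-- The coefficientwise extension of an algebra homomorphism, conjugated by a series. -/
def conjAlg (φ : A →ₐ[k] B) (F G : B⟦X⟧) (hFG : F * G = 1) (hGF : G * F = 1) :
    A⟦X⟧ →ₐ[k] B⟦X⟧ where
  toFun z := F * mapAlgHom φ z * G
  map_one' := by rw [map_one, mul_one, hFG]
  map_mul' u v := by
    calc F * mapAlgHom φ (u * v) * G = F * mapAlgHom φ u * 1 * mapAlgHom φ v * G := by
          rw [map_mul]; noncomm_ring
      _ = F * mapAlgHom φ u * (G * F) * mapAlgHom φ v * G := by rw [hGF]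
      _ = _ := by noncomm_ring
  map_zero' := by rw [map_zero, mul_zero, zero_mul]
  map_add' u v := by rw [map_add, mul_add, add_mul]
  commutes' r := by rw [AlgHom.commutes, ← Algebra.commutes, mul_assoc, hFG, mul_one]

end XLinear

/-! ### Drinfeld twists -/

section Sandwich

variable {k : Type*} [CommRing k] {A : Type*} [Ring A] [Algebra k A] {φ ψ : A →ₗ[k] A}

/-- The bilinear map `(c, a ⊗ b) ↦ φ a * c * ψ b`. For `φ`, `ψ` the antipode and the identity it
evaluates both sides of the antipode axioms and the elements `m (S ⊗ id) G`, `m (id ⊗ S) F` of a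
twist. -/
def sandwich (φ ψ : A →ₗ[k] A) : A →ₗ[k] A ⊗[k] A →ₗ[k] A :=
  (TensorProduct.lift ((LinearMap.mul k (Module.End k A)).compl₁₂
    (LinearMap.mul k A ∘ₗ φ) ((LinearMap.mul k A).flip ∘ₗ ψ))).flip

theorem sandwich_tmul (c a b : A) : sandwich φ ψ c (a ⊗ₜ b) = φ a * c * ψ b :=
  (mul_assoc _ _ _).symm

theorem sandwich_one_id_right (z : A ⊗[k] A) :
    sandwich φ .id 1 z = LinearMap.mul' k A (φ.rTensor A z) := by
  induction z using TensorProduct.induction_on with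
  | zero => simp only [map_zero]
  | tmul a b => rw [sandwich_tmul, mul_one]; rfl
  | add u v hu hv => rw [map_add, hu, hv, map_add, map_add]

theorem sandwich_one_id_left (z : A ⊗[k] A) :
    sandwich .id ψ 1 z = LinearMap.mul' k A (ψ.lTensor A z) := by
  induction z using TensorProduct.induction_on with
  | zero => simp only [map_zero]
  | tmul a b => rw [sandwich_tmul, mul_one]; rfl
  | add u v hu hv => rw [map_add, hu, hv, map_add, map_add]

theorem sandwich_mul_of_antihom_left (hφ : ∀ a b, φ (a * b) = φ b * φ a)
    (hψ : ∀ a b, ψ (a * b) = ψ a * ψ b) (c : A) (z w : A ⊗[k] A) :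
    sandwich φ ψ c (z * w) = sandwich φ ψ (sandwich φ ψ c z) w := by
  induction z using TensorProduct.induction_on with
  | zero => simp
  | add u v hu hv => rw [add_mul, map_add, hu, hv, map_add, map_add, LinearMap.add_apply]
  | tmul a b =>
    induction w using TensorProduct.induction_on with
    | zero => simp
    | add u v hu hv => rw [mul_add, map_add, hu, hv, map_add]
    | tmul x y =>
      rw [Algebra.TensorProduct.tmul_mul_tmul, sandwich_tmul, sandwich_tmul, sandwich_tmul, hφ, hψ]
      noncomm_ring

theorem sandwich_mul_of_antihom_right (hφ : ∀ a b, φ (a * b) = φ a * φ b)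
    (hψ : ∀ a b, ψ (a * b) = ψ b * ψ a) (c : A) (z w : A ⊗[k] A) :
    sandwich φ ψ c (z * w) = sandwich φ ψ (sandwich φ ψ c w) z := by
  induction z using TensorProduct.induction_on with
  | zero => simp
  | add u v hu hv => rw [add_mul, map_add, hu, hv, map_add]
  | tmul a b =>
    induction w using TensorProduct.induction_on with
    | zero => simp
    | add u v hu hv => rw [mul_add, map_add, hu, hv, map_add, map_add, LinearMap.add_apply]
    | tmul x y =>
      rw [Algebra.TensorProduct.tmul_mul_tmul, sandwich_tmul, sandwich_tmul, sandwich_tmul, hφ, hψ]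
      noncomm_ring

theorem bilin_sandwich_tmul (K : A⟦X⟧) (a b : A) :
    bilin (sandwich φ ψ) K (C (a ⊗ₜ b)) = C (φ a) * K * C (ψ b) := by
  ext N
  rw [coeff_bilin_C, sandwich_tmul, coeff_mul_C, coeff_C_mul]

theorem bilin_sandwich_one_right (hφ : φ 1 = 1) (hψ : ψ 1 = 1) (K : A⟦X⟧) :
    bilin (sandwich φ ψ) K 1 = K := by
  rw [← map_one (C (R := A ⊗[k] A)), Algebra.TensorProduct.one_def, bilin_sandwich_tmul, hφ, hψ,
    map_one, one_mul, mul_one]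

theorem bilin_sandwich_mul_of_antihom_left (hφ : ∀ a b, φ (a * b) = φ b * φ a)
    (hψ : ∀ a b, ψ (a * b) = ψ a * ψ b) (K : A⟦X⟧) (z w : (A ⊗[k] A)⟦X⟧) :
    bilin (sandwich φ ψ) K (z * w) = bilin (sandwich φ ψ) (bilin (sandwich φ ψ) K z) w := by
  apply IsXLinear.ext K
  intro c
  apply IsXLinear.ext z
  intro u
  apply IsXLinear.ext w
  intro v
  rw [← map_mul, bilin_C_C, bilin_C_C, bilin_C_C, sandwich_mul_of_antihom_left hφ hψ]

theorem bilin_sandwich_mul_of_antihom_right (hφ : ∀ a b, φ (a * b) = φ a * φ b)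
    (hψ : ∀ a b, ψ (a * b) = ψ b * ψ a) (K : A⟦X⟧) (z w : (A ⊗[k] A)⟦X⟧) :
    bilin (sandwich φ ψ) K (z * w) = bilin (sandwich φ ψ) (bilin (sandwich φ ψ) K w) z := by
  apply IsXLinear.ext K
  intro c
  apply IsXLinear.ext z
  intro u
  apply IsXLinear.ext w
  intro v
  rw [← map_mul, bilin_C_C, bilin_C_C, bilin_C_C, sandwich_mul_of_antihom_right hφ hψ]

theorem bilin_sandwich_scalar (c : k⟦X⟧) (z : (A ⊗[k] A)⟦X⟧) :
    bilin (sandwich φ ψ) (scalar k A c) z = scalar k A c * bilin (sandwich φ ψ) 1 z := by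
  apply IsXLinear.ext_tmul z
  intro a b
  rw [bilin_sandwich_tmul, bilin_sandwich_tmul, mul_one, ← (scalar_commute c _).eq, mul_assoc]

end Sandwich

section Twist

open Coalgebra HopfAlgebra

variable (k : Type*) [CommRing k] (A : Type*) [Ring A] [HopfAlgebra k A]

/-- `a ⊗ b ↦ a ⊗ b ⊗ 1`. -/
def legs12 : A ⊗[k] A →ₐ[k] A ⊗[k] (A ⊗[k] A) :=
  Algebra.TensorProduct.map (AlgHom.id k A) Algebra.TensorProduct.includeLeft

/-- `a ⊗ b ↦ 1 ⊗ a ⊗ b`. -/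
def legs23 : A ⊗[k] A →ₐ[k] A ⊗[k] (A ⊗[k] A) := Algebra.TensorProduct.includeRight

/-- The coproduct of the first tensor factor. -/
def comulFst : A ⊗[k] A →ₐ[k] A ⊗[k] (A ⊗[k] A) :=
  (Algebra.TensorProduct.assoc k k k A A A).toAlgHom.comp
    (Algebra.TensorProduct.map (Bialgebra.comulAlgHom k A) (AlgHom.id k A))

/-- The coproduct of the second tensor factor. -/
def comulSnd : A ⊗[k] A →ₐ[k] A ⊗[k] (A ⊗[k] A) :=
  Algebra.TensorProduct.map (AlgHom.id k A) (Bialgebra.comulAlgHom k A)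

/-- The counit of the first tensor factor. -/
def counitFst : A ⊗[k] A →ₐ[k] A :=
  (Algebra.TensorProduct.lid k A).toAlgHom.comp
    (Algebra.TensorProduct.map (Bialgebra.counitAlgHom k A) (AlgHom.id k A))

/-- The counit of the second tensor factor. -/
def counitSnd : A ⊗[k] A →ₐ[k] A :=
  (Algebra.TensorProduct.rid k k A).toAlgHom.comp
    (Algebra.TensorProduct.map (AlgHom.id k A) (Bialgebra.counitAlgHom k A))

variable {k A}

/-- The map `a ⊗ b ↦ S(a) K b` on series; for `K = 1` it is `m (S ⊗ id)`. -/
def antipodeFst (K : A⟦X⟧) (z : (A ⊗[k] A)⟦X⟧) : A⟦X⟧ :=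
  bilin (sandwich (antipode k) .id) K z

/-- The map `a ⊗ b ↦ a K S(b)` on series; for `K = 1` it is `m (id ⊗ S)`. -/
def antipodeSnd (K : A⟦X⟧) (z : (A ⊗[k] A)⟦X⟧) : A⟦X⟧ :=
  bilin (sandwich .id (antipode k)) K z

theorem antipodeFst_mul (K : A⟦X⟧) (z w : (A ⊗[k] A)⟦X⟧) :
    antipodeFst K (z * w) = antipodeFst (antipodeFst K z) w :=
  bilin_sandwich_mul_of_antihom_left antipode_mul_antidistrib (fun _ _ => rfl) K z w

theorem antipodeSnd_mul (K : A⟦X⟧) (z w : (A ⊗[k] A)⟦X⟧) :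
    antipodeSnd K (z * w) = antipodeSnd (antipodeSnd K w) z :=
  bilin_sandwich_mul_of_antihom_right (fun _ _ => rfl) antipode_mul_antidistrib K z w

theorem antipodeFst_one_right (K : A⟦X⟧) : antipodeFst K (1 : (A ⊗[k] A)⟦X⟧) = K :=
  bilin_sandwich_one_right antipode_one rfl K

theorem antipodeSnd_one_right (K : A⟦X⟧) : antipodeSnd K (1 : (A ⊗[k] A)⟦X⟧) = K :=
  bilin_sandwich_one_right rfl antipode_one K

theorem antipodeFst_scalar (c : k⟦X⟧) (z : (A ⊗[k] A)⟦X⟧) :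
    antipodeFst (scalar k A c) z = scalar k A c * antipodeFst 1 z :=
  bilin_sandwich_scalar c z

theorem antipodeSnd_scalar (c : k⟦X⟧) (z : (A ⊗[k] A)⟦X⟧) :
    antipodeSnd (scalar k A c) z = scalar k A c * antipodeSnd 1 z :=
  bilin_sandwich_scalar c z

theorem antipodeFst_comul (a : A⟦X⟧) :
    antipodeFst 1 (mapAlgHom (Bialgebra.comulAlgHom k A) a) =
      scalar k A (mapAlgHom (Bialgebra.counitAlgHom k A) a) := by
  rw [antipodeFst]
  apply IsXLinear.ext a
  intro x
  rw [mapAlgHom_C, mapAlgHom_C, scalar_C, ← map_one C, bilin_C_C,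
    sandwich_one_id_right]
  exact congrArg C (mul_antipode_rTensor_comul_apply x)

theorem antipodeSnd_comul (a : A⟦X⟧) :
    antipodeSnd 1 (mapAlgHom (Bialgebra.comulAlgHom k A) a) =
      scalar k A (mapAlgHom (Bialgebra.counitAlgHom k A) a) := by
  rw [antipodeSnd]
  apply IsXLinear.ext a
  intro x
  rw [mapAlgHom_C, mapAlgHom_C, scalar_C, ← map_one C, bilin_C_C,
    sandwich_one_id_left]
  exact congrArg C (mul_antipode_lTensor_comul_apply x)

theorem assoc_tmul_eq_legs12_mul (w : A ⊗[k] A) (y : A) :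
    TensorProduct.assoc k A A A (w ⊗ₜ y) = legs12 k A w * 1 ⊗ₜ (1 ⊗ₜ y) := by
  induction w using TensorProduct.induction_on with
  | zero => simp
  | tmul a b => simp [legs12]
  | add u v hu hv => rw [TensorProduct.add_tmul, map_add, map_add, add_mul, hu, hv]

theorem tmul_eq_mul_legs23 (x : A) (w : A ⊗[k] A) : x ⊗ₜ w = x ⊗ₜ 1 * legs23 k A w := by
  simp [legs23]

theorem legs12_commute (z : (A ⊗[k] A)⟦X⟧) (y : A) :
    mapAlgHom (legs12 k A) z * C (1 ⊗ₜ (1 ⊗ₜ y)) =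
      C (1 ⊗ₜ (1 ⊗ₜ y)) * mapAlgHom (legs12 k A) z := by
  apply IsXLinear.ext_tmul z
  intro a b
  rw [mapAlgHom_C, ← map_mul, ← map_mul]
  simp [legs12]

theorem legs23_commute (x : A) (z : (A ⊗[k] A)⟦X⟧) :
    mapAlgHom (legs23 k A) z * C (x ⊗ₜ 1) = C (x ⊗ₜ 1) * mapAlgHom (legs23 k A) z := by
  apply IsXLinear.ext_tmul z
  intro a b
  rw [mapAlgHom_C, ← map_mul, ← map_mul]
  simp [legs23]

theorem lid_rTens_counit (z : (A ⊗[k] A)⟦X⟧) :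
    mapCoeff (TensorProduct.lid k A).toLinearMap
        (rTens A (mapAlgHom (Bialgebra.counitAlgHom k A)).toLinearMap z) =
      mapAlgHom (counitFst k A) z := by
  apply IsXLinear.ext_tmul z
  intro x y
  ext N
  rw [mapCoeff, coeff_mk, coeff_rTens_C, AlgHom.toLinearMap_apply, mapAlgHom_C, mapAlgHom_C,
    coeff_C, coeff_C]
  split_ifs
  · rfl
  · simp

theorem rid_lTens_counit (z : (A ⊗[k] A)⟦X⟧) :
    mapCoeff (TensorProduct.rid k A).toLinearMap
        (lTens A (mapAlgHom (Bialgebra.counitAlgHom k A)).toLinearMap z) =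
      mapAlgHom (counitSnd k A) z := by
  apply IsXLinear.ext_tmul z
  intro x y
  ext N
  rw [mapCoeff, coeff_mk, coeff_lTens_C, AlgHom.toLinearMap_apply, mapAlgHom_C, mapAlgHom_C,
    coeff_C, coeff_C]
  split_ifs
  · rfl
  · simp

theorem counitFst_comp_comul :
    (counitFst k A).comp (Bialgebra.comulAlgHom k A) = AlgHom.id k A := by
  ext x
  change TensorProduct.lid k A (counit.rTensor A (comul x)) = x
  rw [rTensor_counit_comul, TensorProduct.lid_tmul, one_smul]

theorem counitSnd_comp_comul :
    (counitSnd k A).comp (Bialgebra.comulAlgHom k A) = AlgHom.id k A := by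
  ext x
  change TensorProduct.rid k A (counit.lTensor A (comul x)) = x
  rw [lTensor_counit_comul, TensorProduct.rid_tmul, one_smul]

theorem mapCoeff_smul (φ : A →ₗ[k] A) (c : k) (z : A⟦X⟧) :
    mapCoeff φ (c • z) = c • mapCoeff φ z := by
  ext N
  simp only [mapCoeff, coeff_mk, coeff_smul, map_smul]

theorem mapCoeff_scalar_mul (φ : A →ₗ[k] A) (c : k⟦X⟧) (z : A⟦X⟧) :
    mapCoeff φ (scalar k A c * z) = scalar k A c * mapCoeff φ z := by
  apply IsXLinear.ext c
  intro r
  apply IsXLinear.ext z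
  intro a
  rw [scalar_C, ← map_mul, mapCoeff_C, mapCoeff_C, ← map_mul, ← Algebra.smul_def, map_smul,
    Algebra.smul_def]

variable (k) in
/-- The antipode conjugated by the series `u` with inverse `v`. -/
def conjAntipode (u v : A⟦X⟧) : A⟦X⟧ →ₗ[k] A⟦X⟧ where
  toFun z := u * mapCoeff (antipode k) z * v
  map_add' x y := by rw [(isXLinear_mapCoeff _).add, mul_add, add_mul]
  map_smul' c x := by
    rw [mapCoeff_smul, mul_smul_comm, smul_mul_assoc, RingHom.id_apply]

theorem conjAntipode_C (u v : A⟦X⟧) (a : A) :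
    conjAntipode k u v (C a) = u * C (antipode k a) * v :=
  congrArg (u * · * v) (mapCoeff_C _ a)

theorem mul_rTens_conjAntipode (u v : A⟦X⟧) (z : (A ⊗[k] A)⟦X⟧) :
    mapCoeff (LinearMap.mul' k A) (rTens A (conjAntipode k u v) z) =
      u * antipodeFst v z := by
  rw [antipodeFst]
  apply IsXLinear.ext_tmul z
  intro x y
  rw [bilin_sandwich_tmul, ← mul_assoc, ← mul_assoc, ← conjAntipode_C]
  ext N
  rw [mapCoeff, coeff_mk, coeff_rTens_C, LinearMap.mul'_apply, coeff_mul_C, LinearMap.id_apply]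

theorem mul_lTens_conjAntipode (u v : A⟦X⟧) (z : (A ⊗[k] A)⟦X⟧) :
    mapCoeff (LinearMap.mul' k A) (lTens A (conjAntipode k u v) z) =
      antipodeSnd u z * v := by
  rw [antipodeSnd]
  apply IsXLinear.ext_tmul z
  intro x y
  rw [bilin_sandwich_tmul, mul_assoc, mul_assoc, ← mul_assoc u, ← conjAntipode_C]
  ext N
  rw [mapCoeff, coeff_mk, coeff_lTens_C, LinearMap.mul'_apply, coeff_C_mul, LinearMap.id_apply]

/-- A Drinfeld twist `F` with inverse `G`; the last condition says that `m (id ⊗ S) F` and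
`m (S ⊗ id) G`, by which the antipode is conjugated, are mutually inverse. -/
structure IsTwist (F G : (A ⊗[k] A)⟦X⟧) : Prop where
  mul_inv : F * G = 1
  inv_mul : G * F = 1
  cocycle : mapAlgHom (comulFst k A) G * mapAlgHom (legs12 k A) G =
    mapAlgHom (comulSnd k A) G * mapAlgHom (legs23 k A) G
  counit_fst : mapAlgHom (counitFst k A) G = 1
  counit_snd : mapAlgHom (counitSnd k A) G = 1
  antipode : antipodeSnd 1 F * antipodeFst 1 G = 1

namespace IsTwist

variable {F G : (A ⊗[k] A)⟦X⟧}

theorem map_mul_inv {B : Type*} [Ring B] [Algebra k B] (hF : IsTwist F G)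
    (φ : A ⊗[k] A →ₐ[k] B) : mapAlgHom φ F * mapAlgHom φ G = 1 := by
  rw [← map_mul, hF.mul_inv, map_one]

theorem map_inv_mul {B : Type*} [Ring B] [Algebra k B] (hF : IsTwist F G)
    (φ : A ⊗[k] A →ₐ[k] B) : mapAlgHom φ G * mapAlgHom φ F = 1 := by
  rw [← map_mul, hF.inv_mul, map_one]

theorem cocycle_inv (hF : IsTwist F G) :
    mapAlgHom (legs12 k A) F * mapAlgHom (comulFst k A) F =
      mapAlgHom (legs23 k A) F * mapAlgHom (comulSnd k A) F := by
  refine left_inv_eq_right_inv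
    (a := mapAlgHom (comulFst k A) G * mapAlgHom (legs12 k A) G) ?_ ?_
  · rw [mul_assoc, ← mul_assoc (mapAlgHom (comulFst k A) F), hF.map_mul_inv, one_mul,
      hF.map_mul_inv]
  · rw [hF.cocycle, mul_assoc, ← mul_assoc (mapAlgHom (legs23 k A) G), hF.map_inv_mul, one_mul,
      hF.map_inv_mul]

variable (hF : IsTwist F G)

/-- The twisted coproduct `a ↦ F Δ(a) F⁻¹`. -/
def comul : A⟦X⟧ →ₐ[k] (A ⊗[k] A)⟦X⟧ :=
  conjAlg (Bialgebra.comulAlgHom k A) F G hF.mul_inv hF.inv_mul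

theorem comul_apply (a : A⟦X⟧) :
    hF.comul a = F * mapAlgHom (Bialgebra.comulAlgHom k A) a * G := rfl

theorem comul_C (a : A) : hF.comul (C a) = F * C (Coalgebra.comul a) * G := by
  rw [comul_apply, mapAlgHom_C]
  rfl

theorem assoc_rTens_comul (z : (A ⊗[k] A)⟦X⟧) :
    mapCoeff (TensorProduct.assoc k A A A).toLinearMap (rTens A hF.comul.toLinearMap z) =
      mapAlgHom (legs12 k A) F * mapAlgHom (comulFst k A) z * mapAlgHom (legs12 k A) G := by
  apply IsXLinear.ext_tmul z
  intro x y
  have comulFst_tmul : comulFst k A (x ⊗ₜ y) =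
      legs12 k A (Coalgebra.comul x) * 1 ⊗ₜ (1 ⊗ₜ y) := assoc_tmul_eq_legs12_mul _ y
  rw [mapAlgHom_C, comulFst_tmul, map_mul, ← mul_assoc, mul_assoc _ _ (mapAlgHom (legs12 k A) G),
    ← legs12_commute, ← mul_assoc, ← mapAlgHom_C, ← map_mul, ← map_mul, ← hF.comul_C]
  ext N
  rw [mapCoeff, coeff_mk, coeff_rTens_C, coeff_mul_C]
  exact assoc_tmul_eq_legs12_mul _ y

theorem lTens_comul (z : (A ⊗[k] A)⟦X⟧) :
    lTens A hF.comul.toLinearMap z =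
      mapAlgHom (legs23 k A) F * mapAlgHom (comulSnd k A) z * mapAlgHom (legs23 k A) G := by
  apply IsXLinear.ext_tmul z
  intro x y
  have comulSnd_tmul : comulSnd k A (x ⊗ₜ y) = x ⊗ₜ 1 * legs23 k A (Coalgebra.comul y) :=
    tmul_eq_mul_legs23 x _
  rw [mapAlgHom_C, comulSnd_tmul, map_mul, ← mul_assoc, legs23_commute, ← mapAlgHom_C, mul_assoc,
    mul_assoc, ← map_mul, ← map_mul, ← mul_assoc, ← hF.comul_C]
  ext N
  rw [coeff_lTens_C, coeff_C_mul]
  exact tmul_eq_mul_legs23 x _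

theorem coassoc (a : A⟦X⟧) :
    mapCoeff (TensorProduct.assoc k A A A).toLinearMap
        (rTens A hF.comul.toLinearMap (hF.comul a)) =
      lTens A hF.comul.toLinearMap (hF.comul a) := by
  have comul_coassoc : (comulFst k A).comp (Bialgebra.comulAlgHom k A) =
      (comulSnd k A).comp (Bialgebra.comulAlgHom k A) :=
    AlgHom.ext fun x => Coalgebra.coassoc_apply x
  rw [assoc_rTens_comul, lTens_comul, comul_apply]
  simp only [map_mul, mapAlgHom_mapAlgHom, comul_coassoc]
  rw [← mul_assoc, ← mul_assoc, ← mul_assoc, ← mul_assoc, hF.cocycle_inv, mul_assoc _ _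
    (mapAlgHom (legs12 k A) G), hF.cocycle, ← mul_assoc]

theorem counit_left (a : A⟦X⟧) :
    mapCoeff (TensorProduct.lid k A).toLinearMap
      (rTens A (mapAlgHom (Bialgebra.counitAlgHom k A)).toLinearMap (hF.comul a)) = a := by
  have counit_F : mapAlgHom (counitFst k A) F = 1 := by
    simpa only [hF.counit_fst, mul_one] using hF.map_mul_inv (counitFst k A)
  rw [lid_rTens_counit, comul_apply, map_mul, map_mul, counit_F, hF.counit_fst,
    mapAlgHom_mapAlgHom, counitFst_comp_comul, one_mul, mul_one]
  rfl

theorem counit_right (a : A⟦X⟧) :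
    mapCoeff (TensorProduct.rid k A).toLinearMap
      (lTens A (mapAlgHom (Bialgebra.counitAlgHom k A)).toLinearMap (hF.comul a)) = a := by
  have counit_F : mapAlgHom (counitSnd k A) F = 1 := by
    simpa only [hF.counit_snd, mul_one] using hF.map_mul_inv (counitSnd k A)
  rw [rid_lTens_counit, comul_apply, map_mul, map_mul, counit_F, hF.counit_snd,
    mapAlgHom_mapAlgHom, counitSnd_comp_comul, one_mul, mul_one]
  rfl

variable (F G) in
/-- The twisted antipode `a ↦ u S(a) u⁻¹`, `u = m (id ⊗ S) F`. -/
def antipodeMap : A⟦X⟧ →ₗ[k] A⟦X⟧ :=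
  conjAntipode k (antipodeSnd 1 F) (antipodeFst 1 G)

theorem antipode_left (a : A⟦X⟧) :
    mapCoeff (LinearMap.mul' k A) (rTens A (antipodeMap F G) (hF.comul a)) =
      scalar k A (mapAlgHom (Bialgebra.counitAlgHom k A) a) := by
  rw [antipodeMap, mul_rTens_conjAntipode, comul_apply, antipodeFst_mul, antipodeFst_mul,
    ← antipodeFst_mul 1 G F, hF.inv_mul, antipodeFst_one_right, antipodeFst_comul,
    antipodeFst_scalar, ← mul_assoc, ← (scalar_commute _ _).eq, mul_assoc, hF.antipode, mul_one]

theorem antipode_right (a : A⟦X⟧) :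
    mapCoeff (LinearMap.mul' k A) (lTens A (antipodeMap F G) (hF.comul a)) =
      scalar k A (mapAlgHom (Bialgebra.counitAlgHom k A) a) := by
  rw [antipodeMap, mul_lTens_conjAntipode, comul_apply, antipodeSnd_mul, antipodeSnd_mul,
    ← antipodeSnd_mul 1 G F, hF.inv_mul, antipodeSnd_one_right, antipodeSnd_comul,
    antipodeSnd_scalar, mul_assoc, hF.antipode, mul_one]

/-- The topological Hopf algebra obtained from a Drinfeld twist. -/
def formalHopf : FormalHopf k A where
  comul := hF.comul
  counit := mapAlgHom (Bialgebra.counitAlgHom k A)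
  antipode := antipodeMap F G
  comul_scalar c := by
    rw [comul_apply, mapAlgHom_scalar, ← (scalar_commute c F).eq, mul_assoc, hF.mul_inv, mul_one]
  counit_scalar c := by
    rw [mapAlgHom_scalar]
    ext N
    simp [scalar]
  antipode_scalar c a := by
    change _ * mapCoeff (HopfAlgebra.antipode k) (scalar k A c * a) * _ =
      _ * (_ * mapCoeff (HopfAlgebra.antipode k) a * _)
    rw [mapCoeff_scalar_mul, ← mul_assoc, ← (scalar_commute c _).eq, mul_assoc, mul_assoc,
      mul_assoc]
  coassoc := hF.coassoc
  counit_left := hF.counit_left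
  counit_right := hF.counit_right
  antipode_left := hF.antipode_left
  antipode_right := hF.antipode_right

end IsTwist

end Twist

/-! ### Weight vectors and rising factorials -/

section Rise

variable {B : Type*} [Ring B] [Algebra ℂ B] {τ y z : B} {r s : ℂ}

/-- `y` has weight `r` under commutation with `τ`: `[τ, y] = r y`. -/
def HasWeight (τ : B) (r : ℂ) (y : B) : Prop := τ * y = y * τ + r • y

namespace HasWeight

theorem of_commute (h : Commute τ y) : HasWeight τ 0 y := by
  rw [HasWeight, h.eq, zero_smul, add_zero]

theorem mul (hy : HasWeight τ r y) (hz : HasWeight τ s z) : HasWeight τ (r + s) (y * z) := by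
  unfold HasWeight at *
  rw [← mul_assoc, hy, add_mul, mul_assoc, hz, mul_add, smul_mul_assoc, mul_smul_comm, mul_assoc,
    add_smul, add_assoc, add_comm (s • _)]

theorem pow (hy : HasWeight τ r y) (l : ℕ) : HasWeight τ (l * r) (y ^ l) := by
  induction l with
  | zero => simpa using of_commute (Commute.one_right τ)
  | succ l ih =>
    rw [pow_succ, Nat.cast_add_one, add_one_mul]
    exact ih.mul hy

theorem sub (hy : HasWeight τ r y) (hz : HasWeight τ r z) : HasWeight τ r (y - z) := by
  unfold HasWeight at *
  rw [mul_sub, hy, hz, sub_mul, smul_sub]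
  abel

theorem neg (hy : HasWeight τ r y) : HasWeight τ r (-y) := by
  unfold HasWeight at *
  rw [mul_neg, hy, neg_mul, smul_neg, neg_add]

theorem neg_left (hy : HasWeight τ r y) : HasWeight (-τ) (-r) y := by
  unfold HasWeight at *
  rw [neg_mul, hy, mul_neg, neg_smul, neg_add]

theorem add_algebraMap (hy : HasWeight τ r y) (c : ℂ) :
    HasWeight (τ + algebraMap ℂ B c) r y := by
  unfold HasWeight at *
  rw [add_mul, hy, Algebra.commutes, mul_add, add_right_comm]

theorem ad_pow {ε : B} (hε : HasWeight τ 1 ε) (hy : HasWeight τ r y) (l : ℕ) :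
    HasWeight τ (r + l) ((LieAlgebra.ad ℂ B ε ^ l) y) := by
  induction l with
  | zero => simpa using hy
  | succ l ih =>
    rw [pow_succ', Module.End.mul_apply, LieAlgebra.ad_apply, Ring.lie_def, Nat.cast_add_one,
      ← add_assoc]
    refine .sub ?_ (ih.mul hε)
    rw [add_comm]
    exact hε.mul ih

end HasWeight

theorem rise_add (τ : B) (a : ℂ) (l i : ℕ) :
    rise τ a (l + i) = rise τ a l * rise τ (a + l) i := by
  induction i with
  | zero => simp only [add_zero, rise, mul_one]
  | succ i ih =>
    rw [← add_assoc, rise, ih, rise, mul_assoc, Nat.cast_add, add_assoc]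

theorem rise_one (τ : B) (a : ℂ) : rise τ a 1 = τ + algebraMap ℂ B a := by
  simp only [rise, Nat.cast_zero, add_zero, one_mul]

theorem rise_one_add (τ : B) (a : ℂ) (i : ℕ) :
    rise τ a (1 + i) = (τ + algebraMap ℂ B a) * rise τ (a + 1) i := by
  rw [rise_add, rise_one, Nat.cast_one]

theorem rise_zero_succ (j : ℕ) : rise (0 : B) 0 (j + 1) = 0 := by
  rw [add_comm j 1, rise_one_add, map_zero, add_zero, zero_mul]

theorem rise_add_algebraMap (τ : B) (a c : ℂ) (j : ℕ) :
    rise (τ + algebraMap ℂ B c) a j = rise τ (a + c) j := by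
  induction j with
  | zero => rfl
  | succ j ih =>
    rw [rise, ih, rise, add_assoc τ, ← map_add]
    congr 3
    ring

theorem commute_rise (hz : Commute τ z) (a : ℂ) (j : ℕ) : Commute (rise τ a j) z := by
  induction j with
  | zero => exact Commute.one_left z
  | succ j ih => exact ih.mul_left (hz.add_left (Algebra.commutes _ z))

theorem HasWeight.rise_mul (hy : HasWeight τ r y) (a : ℂ) (j : ℕ) :
    rise τ a j * y = y * rise τ (a + r) j := by
  induction j with
  | zero => exact (Commute.one_left y).eq
  | succ j ih =>
    have shift : (τ + algebraMap ℂ B (a + j)) * y = y * (τ + algebraMap ℂ B (a + r + j)) := by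
      rw [hy.add_algebraMap, mul_add, mul_add, ← Algebra.commutes _ y, ← Algebra.commutes _ y,
        ← Algebra.smul_def, ← Algebra.smul_def, add_assoc, ← add_smul]
      ring_nf
    rw [rise, mul_assoc, shift, ← mul_assoc, ih, rise, mul_assoc]

/-- Vandermonde's identity. -/
theorem rise_add_add {σ τ : B} (hστ : Commute σ τ) (a b : ℂ) (n : ℕ) :
    rise (σ + τ) (a + b) n =
      ∑ p ∈ antidiagonal n, n.choose p.1 • (rise σ a p.1 * rise τ b p.2) := by
  induction n with
  | zero => simp [rise]
  | succ n ih =>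
    rw [Finset.sum_antidiagonal_choose_succ_nsmul (fun i j => rise σ a i * rise τ b j), rise, ih,
      Finset.sum_mul, ← Finset.sum_add_distrib]
    refine Finset.sum_congr rfl fun p hp => ?_
    have hn := mem_antidiagonal.mp hp
    have split : σ + τ + algebraMap ℂ B (a + b + n) =
        (τ + algebraMap ℂ B (b + p.2)) + (σ + algebraMap ℂ B (a + p.1)) := by
      simp only [← hn, Nat.cast_add, map_add]
      abel
    have comm : Commute (rise τ b p.2) (σ + algebraMap ℂ B (a + p.1)) :=
      commute_rise (hστ.symm.add_right (Algebra.commutes _ τ).symm) _ _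
    rw [Nat.choose_symm_of_eq_add hn.symm, ← smul_add, smul_mul_assoc, split, mul_add, rise, rise,
      mul_assoc, mul_assoc, mul_assoc, comm.eq]

theorem map_rise {B' : Type*} [Ring B'] [Algebra ℂ B'] (φ : B →ₐ[ℂ] B') (τ : B) (a : ℂ) (j : ℕ) :
    φ (rise τ a j) = rise (φ τ) a j := by
  induction j with
  | zero => exact map_one φ
  | succ j ih => rw [rise, map_mul, ih, map_add, AlgHom.commutes, rise]

theorem C_rise (τ : B) (a : ℂ) (j : ℕ) : (C (rise τ a j) : B⟦X⟧) = rise (C τ) a j := by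
  induction j with
  | zero => exact map_one C
  | succ j ih => rw [rise, map_mul, ih, map_add, rise, PowerSeries.algebraMap_apply]

theorem rise_algebraMap (c a : ℂ) (j : ℕ) :
    rise (algebraMap ℂ B c) a j = algebraMap ℂ B (rise c a j) :=
  (map_rise (Algebra.ofId ℂ B) c a j).symm

theorem prod_range_sub_eq_rise (r : ℂ) (j : ℕ) :
    ∏ i ∈ Finset.range j, (r - (i : ℂ)) = (-1) ^ j * rise (-r) 0 j := by
  induction j with
  | zero => simp [rise]
  | succ j ih =>
    rw [Finset.prod_range_succ, ih, rise, pow_succ, Algebra.algebraMap_self, RingHom.id_apply]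
    ring

theorem rise_neg_neg (τ : B) (l : ℕ) : rise (-τ) (-l) l = (-1 : ℂ) ^ l • rise τ 1 l := by
  induction l with
  | zero => simp only [pow_zero, one_smul, rise]
  | succ l ih =>
    have comm : Commute (rise τ 1 l) (τ + algebraMap ℂ B (l + 1)) :=
      commute_rise ((Commute.refl τ).add_right (Algebra.commutes _ τ).symm) _ _
    have first : -τ + algebraMap ℂ B (-(l + 1)) = (-1 : ℂ) • (τ + algebraMap ℂ B (l + 1)) := by
      rw [map_neg, neg_one_smul, neg_add]
    rw [add_comm l 1, rise_one_add, add_comm 1 l, Nat.cast_add_one, neg_add,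
      neg_add_cancel_right, ih, ← neg_add, first, rise, add_comm 1 (l : ℂ), smul_mul_smul_comm,
      ← comm.eq, pow_succ']

theorem HasWeight.rise_neg_mul_pow (hy : HasWeight τ 1 y) (j : ℕ) :
    rise (-τ) 0 j * y ^ j = (-(τ * y)) ^ j := by
  induction j with
  | zero => rw [pow_zero, pow_zero, rise, one_mul]
  | succ j ih =>
    have shift : (-τ + algebraMap ℂ B (0 + j)) * y ^ j = y ^ j * -τ := by
      have := (hy.pow j).neg_left
      rw [HasWeight] at this
      rw [add_mul, this, zero_add, ← Algebra.smul_def, mul_one, neg_smul, neg_add_cancel_right]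
    rw [rise, pow_succ y, mul_assoc, ← mul_assoc _ (y ^ j), shift, mul_assoc, ← mul_assoc, ih,
      neg_mul, pow_succ]

end Rise

/-! ### Exponential generating series -/

section TSum

variable {B D : Type*} [Ring B] [Ring D]

theorem tSum_eq (F : ℕ → B⟦X⟧) : tSum F = F 0 + tSum (fun j => F (j + 1)) * X := by
  ext N
  cases N with
  | zero => simp [tSum]
  | succ N =>
    rw [map_add, coeff_succ_mul_X, tSum, coeff_mk, Finset.Nat.sum_antidiagonal_succ, tSum, coeff_mk]

theorem tSum_eq_of_three {F : ℕ → B⟦X⟧} (hF : ∀ j, F (j + 3) = 0) :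
    tSum F = F 0 + F 1 * X + F 2 * X ^ 2 := by
  have tail : tSum (fun j => F (j + 1 + 1 + 1)) = 0 := by
    ext N
    simp only [tSum, coeff_mk, hF, map_zero, Finset.sum_const_zero]
  rw [tSum_eq, tSum_eq fun j => F (j + 1), tSum_eq fun j => F (j + 1 + 1), tail, zero_mul, add_zero,
    add_mul, mul_assoc, ← pow_two, ← add_assoc, zero_add, one_add_one_eq_two]

theorem IsXLinear.map_tSum {Φ : B⟦X⟧ → D⟦X⟧} (hΦ : IsXLinear Φ)
    (F : ℕ → B⟦X⟧) : Φ (tSum F) = tSum fun j => Φ (F j) := by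
  ext N
  induction N generalizing F with
  | zero =>
    rw [tSum_eq, tSum_eq fun j => Φ (F j), hΦ.add, hΦ.mul_X]
    simp
  | succ N ih =>
    rw [tSum_eq, tSum_eq fun j => Φ (F j), hΦ.add, hΦ.mul_X, map_add, map_add, coeff_succ_mul_X,
      coeff_succ_mul_X, ih]

theorem mul_tSum (F : ℕ → B⟦X⟧) (Z : B⟦X⟧) : Z * tSum F = tSum fun j => Z * F j :=
  (IsXLinear.mul_left Z).map_tSum F

theorem tSum_mul (F : ℕ → B⟦X⟧) (Z : B⟦X⟧) : tSum F * Z = tSum fun j => F j * Z :=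
  (IsXLinear.mul_right Z).map_tSum F

end TSum

section Egf

variable {B : Type*} [Ring B] [Algebra ℂ B]

/-- The exponential generating series `∑_j p_j / j! t^j`. -/
def egf (p : ℕ → B) : B⟦X⟧ := PowerSeries.mk fun j => ((j.factorial : ℂ)⁻¹) • p j

theorem coeff_egf (p : ℕ → B) (j : ℕ) : coeff j (egf p) = ((j.factorial : ℂ)⁻¹) • p j :=
  coeff_mk _ _

theorem inv_factorial_mul_inv_factorial {N : ℕ} {x : ℕ × ℕ} (hx : x ∈ antidiagonal N) :
    ((x.1.factorial : ℂ)⁻¹) * ((x.2.factorial : ℂ)⁻¹) =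
      ((N.factorial : ℂ)⁻¹) * (N.choose x.1 : ℂ) := by
  have := Nat.cast_ne_zero (R := ℂ).mpr (x.1 + x.2).factorial_ne_zero
  rw [← mem_antidiagonal.mp hx, Nat.cast_add_choose]
  field_simp

theorem tSum_egf (p : ℕ → ℕ → B) :
    tSum (fun l => ((l.factorial : ℂ)⁻¹) • egf (p l)) =
      egf fun N => ∑ x ∈ antidiagonal N, N.choose x.1 • p x.1 x.2 := by
  ext N
  rw [tSum, coeff_mk, coeff_egf, Finset.smul_sum]
  refine Finset.sum_congr rfl fun x hx => ?_
  change ((x.1.factorial : ℂ)⁻¹) • coeff x.2 (egf (p x.1)) = _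
  rw [coeff_egf, smul_smul, inv_factorial_mul_inv_factorial hx, mul_smul, Nat.cast_smul_eq_nsmul]

theorem egf_mul_egf (p p' : ℕ → B) :
    egf p * egf p' = egf fun N => ∑ x ∈ antidiagonal N, N.choose x.1 • (p x.1 * p' x.2) := by
  ext N
  rw [coeff_mul, coeff_egf, Finset.smul_sum]
  refine Finset.sum_congr rfl fun x hx => ?_
  rw [coeff_egf, coeff_egf, smul_mul_smul_comm, inv_factorial_mul_inv_factorial hx, mul_smul,
    Nat.cast_smul_eq_nsmul]

theorem C_mul_egf (z : B) (p : ℕ → B) : C z * egf p = egf fun j => z * p j := by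
  ext N
  rw [coeff_C_mul, coeff_egf, coeff_egf, mul_smul_comm]

theorem C_smul (c : ℂ) (z : B) : (C (c • z) : B⟦X⟧) = c • C z := by
  ext N
  rw [coeff_smul, coeff_C, coeff_C, smul_ite, smul_zero]

theorem egf_mul_C (z : B) (p : ℕ → B) : egf p * C z = egf fun j => p j * z := by
  ext N
  rw [coeff_mul_C, coeff_egf, coeff_egf, smul_mul_assoc]

theorem mapAlgHom_egf {B' : Type*} [Ring B'] [Algebra ℂ B'] (φ : B →ₐ[ℂ] B') (p : ℕ → B) :
    mapAlgHom φ (egf p) = egf fun j => φ (p j) := by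
  ext N
  rw [mapAlgHom_apply, coeff_map, coeff_egf, coeff_egf]
  exact map_smul φ _ _

theorem egf_eq_one {p : ℕ → B} (h0 : p 0 = 1) (hs : ∀ j, p (j + 1) = 0) : egf p = 1 := by
  ext N
  rw [coeff_egf, coeff_one]
  cases N with
  | zero => simp [h0]
  | succ N => simp [hs]

theorem egf_pow_mul_egf_neg_pow (z : B) : (egf fun j => z ^ j) * (egf fun j => (-z) ^ j) = 1 := by
  rw [egf_mul_egf]
  simp only [← (Commute.refl z).neg_right.add_pow', add_neg_cancel]
  exact egf_eq_one (pow_zero 0) fun j => zero_pow j.succ_ne_zero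

end Egf

/-! ### Powers of `1 - ε t` with operator exponents -/

section NegPow

variable {B : Type*} [Ring B] [Algebra ℂ B] {σ τ ε y : B} {r : ℂ}

/-- The series `(1 - ε t)^{-τ} = ∑_j τ (τ + 1) ⋯ (τ + j - 1) ε^j / j! t^j`, with the powers of
`ε` on the right. -/
def negPow (τ ε : B) : B⟦X⟧ := egf fun j => rise τ 0 j * ε ^ j

theorem negPow_zero_left (ε : B) : negPow 0 ε = 1 :=
  egf_eq_one (by rw [rise, pow_zero, one_mul]) fun j => by rw [rise_zero_succ, zero_mul]

theorem negPow_zero_right (τ : B) : negPow τ 0 = 1 :=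
  egf_eq_one (by rw [rise, pow_zero, one_mul]) fun j => by rw [pow_succ, mul_zero, mul_zero]

theorem mapAlgHom_negPow {B' : Type*} [Ring B'] [Algebra ℂ B'] (φ : B →ₐ[ℂ] B') (τ ε : B) :
    mapAlgHom φ (negPow τ ε) = negPow (φ τ) (φ ε) := by
  simp only [negPow, mapAlgHom_egf, map_mul, map_rise, map_pow]

theorem oneSubPow_eq_negPow (ε : B) (r : ℂ) :
    oneSubPow ε r = negPow (algebraMap ℂ B (-r)) ε := by
  ext j
  rw [oneSubPow, coeff_mk, negPow, coeff_egf, prod_range_sub_eq_rise, rise_algebraMap,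
    ← Algebra.smul_def, smul_smul, ← neg_one_smul ℂ ε, smul_pow, smul_smul]
  congr 1
  have sign : ((-1 : ℂ) ^ j) * (-1) ^ j = 1 := by rw [← mul_pow, neg_one_mul, neg_neg, one_pow]
  linear_combination ((j.factorial : ℂ)⁻¹ * rise (-r) 0 j) * sign

theorem mapAlgHom_oneSubPow {B' : Type*} [Ring B'] [Algebra ℂ B'] (φ : B →ₐ[ℂ] B') (ε : B)
    (r : ℂ) : mapAlgHom φ (oneSubPow ε r) = oneSubPow (φ ε) r := by
  rw [oneSubPow_eq_negPow, mapAlgHom_negPow, AlgHom.commutes, oneSubPow_eq_negPow]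

theorem oneSubPow_zero (ε : B) : oneSubPow ε 0 = 1 := by
  rw [oneSubPow_eq_negPow, neg_zero, map_zero, negPow_zero_left]

theorem coeff_oneSubPow_neg_one (ε : B) (j : ℕ) : coeff j (oneSubPow ε (-1)) = ε ^ j := by
  have rise_eq : rise (1 : ℂ) 0 j = j.factorial := by
    induction j with
    | zero => simp [rise]
    | succ j ih =>
      rw [rise, ih, Nat.factorial_succ, zero_add, Algebra.algebraMap_self, RingHom.id_apply]
      push_cast
      ring
  have factorial_ne_zero := Nat.cast_ne_zero (R := ℂ).mpr j.factorial_ne_zero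
  rw [oneSubPow_eq_negPow, neg_neg, negPow, coeff_egf, rise_algebraMap, rise_eq,
    ← Algebra.smul_def, smul_smul, inv_mul_cancel₀ factorial_ne_zero, one_smul]

theorem oneSubPow_neg_one_mul (ε : B) :
    oneSubPow ε (-1) * C ε * X = oneSubPow ε (-1) - 1 := by
  ext N
  cases N with
  | zero => rw [coeff_zero_mul_X, map_sub, coeff_oneSubPow_neg_one, pow_zero, coeff_zero_one,
      sub_self]
  | succ N => rw [coeff_succ_mul_X, coeff_mul_C, map_sub, coeff_oneSubPow_neg_one,
      coeff_oneSubPow_neg_one, coeff_one, if_neg N.succ_ne_zero, sub_zero, pow_succ]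

theorem negPow_add (hστ : Commute σ τ) (hτ : Commute τ ε) :
    negPow (σ + τ) ε = negPow σ ε * negPow τ ε := by
  rw [negPow, negPow, negPow, egf_mul_egf]
  congr 1
  funext N
  have vandermonde := rise_add_add hστ 0 0 N
  rw [add_zero] at vandermonde
  rw [vandermonde, Finset.sum_mul]
  refine Finset.sum_congr rfl fun x hx => ?_
  rw [smul_mul_assoc, ← mem_antidiagonal.mp hx, pow_add, mul_assoc, mul_assoc,
    ← mul_assoc _ (ε ^ x.1), ((commute_rise hτ 0 x.2).pow_right x.1).eq, mul_assoc]

theorem negPow_neg_mul (hτ : Commute τ ε) : negPow (-τ) ε * negPow τ ε = 1 := by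
  rw [← negPow_add (Commute.refl τ).neg_left hτ, neg_add_cancel, negPow_zero_left]

theorem negPow_mul_neg (hτ : Commute τ ε) : negPow τ ε * negPow (-τ) ε = 1 := by
  rw [← negPow_add (Commute.refl τ).neg_right hτ.neg_left, add_neg_cancel, negPow_zero_left]

theorem HasWeight.negPow_mul_C (hy : HasWeight τ r y) (hε : Commute ε y) :
    negPow τ ε * C y = C y * negPow (τ + algebraMap ℂ B r) ε := by
  rw [negPow, negPow, egf_mul_C, C_mul_egf]
  congr 1
  funext j
  rw [rise_add_algebraMap, mul_assoc, (hε.pow_left j).eq, ← mul_assoc, hy.rise_mul, mul_assoc]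

/-- Taylor expansion of `(1 - (α + ε) t)^{-τ}` around `ε`. -/
theorem negPow_add_right {α : B} (hτ : Commute τ α) (hα : Commute α ε) :
    negPow τ (α + ε) = tSum fun l => ((l.factorial : ℂ)⁻¹) •
      (C (rise τ 0 l * α ^ l) * negPow (τ + algebraMap ℂ B (l : ℂ)) ε) := by
  simp only [negPow, C_mul_egf, tSum_egf, hα.add_pow', Finset.mul_sum]
  congr 1
  funext N
  refine Finset.sum_congr rfl fun x hx => ?_
  have hτα : Commute (rise τ x.1 x.2) (α ^ x.1) := (commute_rise hτ _ _).pow_right _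
  rw [mul_smul_comm, rise_add_algebraMap, ← mem_antidiagonal.mp hx, rise_add, zero_add, mul_assoc,
    mul_assoc, ← mul_assoc _ (α ^ _), hτα.eq, mul_assoc]

/-- The 2-cocycle condition for the twist: `T₁`, `T₂` stand for `T ⊗ 1 ⊗ 1`, `1 ⊗ T ⊗ 1` and
`E₂`, `E₃` for `1 ⊗ E ⊗ 1`, `1 ⊗ 1 ⊗ E`. -/
theorem negPow_cocycle {T₁ T₂ E₂ E₃ : B} (hT : Commute T₁ T₂) (hT₁E₂ : Commute T₁ E₂)
    (hT₁E₃ : Commute T₁ E₃) (hT₂E₃ : Commute T₂ E₃) (hE : Commute E₂ E₃)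
    (hT₂E₂ : HasWeight T₂ 1 E₂) :
    negPow (T₁ + T₂) E₃ * negPow T₁ E₂ = negPow T₁ (E₂ + E₃) * negPow T₂ E₃ := by
  have expand : negPow T₁ E₂ =
      tSum fun l => ((l.factorial : ℂ)⁻¹) • C (rise T₁ 0 l * E₂ ^ l) := by
    have taylor := negPow_add_right hT₁E₂ (Commute.zero_right E₂)
    simpa only [add_zero, negPow_zero_right, mul_one] using taylor
  rw [expand, mul_tSum, negPow_add_right hT₁E₂ hE, tSum_mul]
  congr 1
  funext l
  have rise_comm : Commute (T₁ + T₂) (rise T₁ 0 l) :=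
    (commute_rise ((Commute.refl T₁).add_right hT) _ _).symm
  have pow_weight : HasWeight (T₁ + T₂) (l * 1) (E₂ ^ l) := by
    refine HasWeight.pow ?_ l
    rw [HasWeight, add_mul, hT₂E₂, hT₁E₂.eq, mul_add, add_assoc]
  have weight := (HasWeight.of_commute rise_comm).mul pow_weight
  rw [zero_add, mul_one] at weight
  have comm : Commute E₃ (rise T₁ 0 l * E₂ ^ l) :=
    (commute_rise hT₁E₃ _ _).symm.mul_right (hE.pow_left _).symm
  rw [mul_smul_comm, smul_mul_assoc, weight.negPow_mul_C comm, add_right_comm,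
    negPow_add (hT.add_left (Algebra.commutes _ T₂)) hT₂E₃, mul_assoc]

theorem negPow_conj_of_hasWeight (hτ : Commute τ ε) (hε : Commute ε y) (hy : HasWeight τ r y) :
    negPow (-τ) ε * C y * negPow τ ε = C y * oneSubPow ε r := by
  have comm : Commute (-τ + algebraMap ℂ B (-r)) τ :=
    (Commute.refl τ).neg_left.add_left (Algebra.commutes _ τ)
  rw [hy.neg_left.negPow_mul_C hε, mul_assoc, ← negPow_add comm hτ, neg_add_cancel_comm,
    oneSubPow_eq_negPow]

theorem ad_neg_pow (ε y : B) (l : ℕ) :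
    (LieAlgebra.ad ℂ B (-ε) ^ l) y = (-1 : ℂ) ^ l • (LieAlgebra.ad ℂ B ε ^ l) y := by
  rw [map_neg, ← neg_one_smul ℂ, smul_pow, LinearMap.smul_apply]

theorem mul_pow_eq_sum (y ε : B) (N : ℕ) :
    y * ε ^ N = ∑ x ∈ antidiagonal N,
      N.choose x.1 • (ε ^ x.2 * (LieAlgebra.ad ℂ B (-ε) ^ x.1) y) := by
  have mulRight_eq : LinearMap.mulRight ℂ ε = LieAlgebra.ad ℂ B (-ε) + LinearMap.mulLeft ℂ ε := by
    ext z
    simp [LieAlgebra.ad_apply, Ring.lie_def]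
  have comm : Commute (LinearMap.mulLeft ℂ ε) (LieAlgebra.ad ℂ B (-ε)) := by
    ext z
    simp only [LinearMap.mulLeft_apply, LieAlgebra.ad_apply, Ring.lie_def, Module.End.mul_apply]
    noncomm_ring
  have expand := congrArg (fun φ => φ y) (comm.symm.add_pow' N)
  simp only [← mulRight_eq, LinearMap.pow_mulRight, LinearMap.mulRight_apply] at expand
  rw [expand, LinearMap.sum_apply]
  refine Finset.sum_congr rfl fun x _ => ?_
  rw [LinearMap.smul_apply, (comm.symm.pow_pow _ _).eq, Module.End.mul_apply,
    LinearMap.pow_mulLeft, LinearMap.mulLeft_apply]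

theorem negPow_conj_of_commute (hε : Commute τ ε) (hy : Commute τ y) :
    negPow (-τ) ε * C y * negPow τ ε = tSum fun l => ((l.factorial : ℂ)⁻¹) •
      (C (rise τ 0 l) * oneSubPow ε (-l) * C ((LieAlgebra.ad ℂ B (-ε) ^ l) y)) := by
  have expand : C y * negPow τ ε = tSum fun l => ((l.factorial : ℂ)⁻¹) •
      (C (rise τ 0 l) * negPow (τ + algebraMap ℂ B (l : ℂ)) ε *
        C ((LieAlgebra.ad ℂ B (-ε) ^ l) y)) := by
    simp only [negPow, C_mul_egf, egf_mul_C, tSum_egf]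
    congr 1
    funext N
    rw [← mul_assoc, ← (commute_rise hy _ _).eq, mul_assoc, mul_pow_eq_sum, Finset.mul_sum]
    refine Finset.sum_congr rfl fun x hx => ?_
    rw [mul_smul_comm, ← mem_antidiagonal.mp hx, rise_add, rise_add_algebraMap, zero_add]
    simp only [mul_assoc]
  rw [mul_assoc, expand, mul_tSum]
  congr 1
  funext l
  have weight : HasWeight (-τ) 0 (rise τ 0 l) :=
    .of_commute (commute_rise (Commute.refl τ).neg_right _ _).symm
  rw [mul_smul_comm, ← mul_assoc, ← mul_assoc,
    weight.negPow_mul_C (commute_rise hε _ _).symm, map_zero, add_zero, mul_assoc (C _),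
    ← negPow_add ((Commute.refl τ).neg_left.add_right (Algebra.commutes _ _).symm)
      (hε.add_left (Algebra.commutes _ _)), neg_add_cancel_left, oneSubPow_eq_negPow, neg_neg]

theorem HasWeight.C_mul_negPow_neg (hε : HasWeight τ 1 ε) (hy : HasWeight τ r y) :
    C y * negPow (-τ) ε = tSum fun l => ((l.factorial : ℂ)⁻¹) •
      (negPow (-τ) ε * oneSubPow ε (-r) * C ((LieAlgebra.ad ℂ B ε ^ l) y * rise τ 1 l)) := by
  have negPow_eq : negPow (-τ) ε * oneSubPow ε (-r) = negPow (-τ + algebraMap ℂ B r) ε := by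
    rw [oneSubPow_eq_negPow, neg_neg,
      ← negPow_add (Algebra.commutes _ _).symm (Algebra.commutes _ _)]
  simp only [negPow_eq]
  simp only [negPow, C_mul_egf, egf_mul_C, tSum_egf]
  congr 1
  funext N
  have move : y * rise (-τ) 0 N = rise (-τ) r N * y := by
    rw [hy.neg_left.rise_mul, add_neg_cancel]
  rw [← mul_assoc, move, mul_assoc, mul_pow_eq_sum, Finset.mul_sum]
  refine Finset.sum_congr rfl fun x hx => ?_
  have pow_weight : HasWeight (-τ) (-x.2) (ε ^ x.2) := by
    simpa only [mul_one] using (hε.pow x.2).neg_left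
  have ad_weight := (hε.ad_pow hy x.1).neg_left
  rw [mul_smul_comm, ← mem_antidiagonal.mp hx, add_comm x.1, rise_add, rise_add_algebraMap,
    zero_add, mul_assoc, ← mul_assoc _ (ε ^ x.2), pow_weight.rise_mul, add_neg_cancel_right,
    ad_neg_pow, mul_smul_comm, mul_assoc (ε ^ x.2), ad_weight.rise_mul, neg_add,
    add_neg_cancel_left, rise_neg_neg]
  simp only [mul_smul_comm, smul_smul, ← mul_pow, neg_one_mul, neg_neg, one_pow, one_smul,
    mul_assoc]

end NegPow

/-! ### The Jordanian twist -/

section Primitive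

open Coalgebra HopfAlgebra

variable {A : Type*} [Ring A] [HopfAlgebra ℂ A] {y : A}

/-- The primitive elements of a Hopf algebra, `Δ(y) = y ⊗ 1 + 1 ⊗ y`. -/
def IsPrimitive (y : A) : Prop := comul (R := ℂ) y = y ⊗ₜ[ℂ] 1 + 1 ⊗ₜ[ℂ] y

theorem IsPrimitive.counit_eq_zero (hy : IsPrimitive y) : counit (R := ℂ) y = 0 := by
  have counit_identity := congrArg (TensorProduct.lid ℂ A) (rTensor_counit_comul (R := ℂ) y)
  rw [hy, map_add, LinearMap.rTensor_tmul, LinearMap.rTensor_tmul, map_add,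
    TensorProduct.lid_tmul, TensorProduct.lid_tmul, TensorProduct.lid_tmul,
    Bialgebra.counit_one, one_smul, add_eq_right] at counit_identity
  simpa using congrArg (counit (R := ℂ)) counit_identity

theorem IsPrimitive.antipode_eq_neg (hy : IsPrimitive y) : antipode ℂ y = -y := by
  have antipode_identity := mul_antipode_rTensor_comul_apply (R := ℂ) y
  rw [hy.counit_eq_zero, hy, map_add, LinearMap.rTensor_tmul, LinearMap.rTensor_tmul, map_add,
    LinearMap.mul'_apply, LinearMap.mul'_apply, antipode_one, mul_one, one_mul,
    map_zero] at antipode_identity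
  exact eq_neg_of_add_eq_zero_left antipode_identity

theorem antipode_pow (y : A) (j : ℕ) : antipode ℂ (y ^ j) = antipode ℂ y ^ j := by
  induction j with
  | zero => rw [pow_zero, pow_zero, antipode_one]
  | succ j ih => rw [pow_succ, antipode_mul_antidistrib, ih, pow_succ']

theorem IsPrimitive.antipode_rise (hy : IsPrimitive y) (a : ℂ) (j : ℕ) :
    antipode ℂ (rise y a j) = rise (-y) a j := by
  induction j with
  | zero => exact antipode_one
  | succ j ih =>
    have antipode_algebraMap : antipode ℂ (algebraMap ℂ A (a + j)) = algebraMap ℂ A (a + j) := by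
      rw [Algebra.algebraMap_eq_smul_one, map_smul, antipode_one]
    have comm : Commute (rise (-y) a j) (-y + algebraMap ℂ A (a + j)) :=
      commute_rise ((Commute.refl (-y)).add_right (Algebra.commutes _ _).symm) a j
    rw [rise, antipode_mul_antidistrib, ih, map_add, hy.antipode_eq_neg, antipode_algebraMap,
      ← comm.eq, rise]

end Primitive

section Tens

variable {k : Type*} [CommRing k] {A B : Type*} [Ring A] [Algebra k A] [Ring B] [Algebra k B]

theorem tens_C_left (a : A) (v : A⟦X⟧) :
    tens k (C a) v = C (a ⊗ₜ 1) * mapAlgHom (Algebra.TensorProduct.includeRight) v :=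
  congrArg (· * _) (map_C _ a)

theorem tens_one_left_C (a : A) : tens k 1 (C a) = C (1 ⊗ₜ a) := by
  rw [tens, map_one, one_mul]
  exact map_C _ a

theorem tens_smul (c : k) (u v : A⟦X⟧) : tens k u (c • v) = c • tens k u v := by
  have map_smul : PowerSeries.map
      (Algebra.TensorProduct.includeRight : A →ₐ[k] A ⊗[k] A).toRingHom (c • v) =
        c • PowerSeries.map (Algebra.TensorProduct.includeRight :
          A →ₐ[k] A ⊗[k] A).toRingHom v := by
    ext N
    simp
  rw [tens, tens, map_smul, mul_smul_comm]

theorem tens_sub (u v w : A⟦X⟧) : tens k u (v - w) = tens k u v - tens k u w := by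
  rw [tens, tens, tens, map_sub, mul_sub]

theorem tens_neg (u v : A⟦X⟧) : tens k u (-v) = -tens k u v := by
  rw [tens, tens, map_neg, mul_neg]

theorem tens_zero (u : A⟦X⟧) : tens k u 0 = 0 := by
  rw [tens, map_zero, mul_zero]

theorem tens_mul_X_pow (u v : A⟦X⟧) (j : ℕ) : tens k u (v * X ^ j) = tens k u v * X ^ j := by
  rw [tens, tens, map_mul, map_pow, map_X, mul_assoc]

theorem ad_pow_map (φ : A →ₐ[k] B) (x y : A) (l : ℕ) :
    (LieAlgebra.ad k B (φ x) ^ l) (φ y) = φ ((LieAlgebra.ad k A x ^ l) y) := by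
  induction l with
  | zero => rfl
  | succ l ih =>
    rw [pow_succ', Module.End.mul_apply, ih, pow_succ', Module.End.mul_apply, LieAlgebra.ad_apply,
      LieAlgebra.ad_apply, Ring.lie_def, Ring.lie_def, map_sub, map_mul, map_mul]

theorem ad_pow_two {x y z₁ z₂ : A} (h1 : ⁅x, y⁆ = z₁) (h2 : ⁅x, z₁⁆ = z₂) :
    (LieAlgebra.ad k A x ^ 2) y = z₂ := by
  rw [pow_two, Module.End.mul_apply, LieAlgebra.ad_apply, LieAlgebra.ad_apply, h1, h2]

theorem ad_pow_add_three {x y z₁ z₂ : A} (h1 : ⁅x, y⁆ = z₁) (h2 : ⁅x, z₁⁆ = z₂)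
    (h3 : ⁅x, z₂⁆ = 0) (j : ℕ) : (LieAlgebra.ad k A x ^ (j + 3)) y = 0 := by
  rw [pow_add, Module.End.mul_apply, pow_succ', Module.End.mul_apply, ad_pow_two h1 h2,
    LieAlgebra.ad_apply, h3, map_zero]

end Tens

section LegMaps

open Coalgebra

variable {A : Type*} [Ring A] [HopfAlgebra ℂ A] {y : A}

theorem comulFst_tmul_one (hy : IsPrimitive y) :
    comulFst ℂ A (y ⊗ₜ 1) = y ⊗ₜ (1 ⊗ₜ 1) + 1 ⊗ₜ (y ⊗ₜ 1) := by
  change TensorProduct.assoc ℂ A A A (comul y ⊗ₜ 1) = _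
  rw [hy, TensorProduct.add_tmul]
  rfl

theorem comulFst_one_tmul (y : A) : comulFst ℂ A (1 ⊗ₜ y) = 1 ⊗ₜ (1 ⊗ₜ y) := by
  change TensorProduct.assoc ℂ A A A (comul 1 ⊗ₜ y) = _
  rw [Bialgebra.comul_one]
  rfl

theorem comulSnd_tmul_one (y : A) : comulSnd ℂ A (y ⊗ₜ 1) = y ⊗ₜ (1 ⊗ₜ 1) := by
  change y ⊗ₜ (comul 1) = _
  rw [Bialgebra.comul_one]
  rfl

theorem comulSnd_one_tmul (hy : IsPrimitive y) :
    comulSnd ℂ A (1 ⊗ₜ y) = 1 ⊗ₜ (y ⊗ₜ 1) + 1 ⊗ₜ (1 ⊗ₜ y) := by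
  change 1 ⊗ₜ (comul y) = _
  rw [hy, TensorProduct.tmul_add]

theorem counitFst_tmul_one (hy : IsPrimitive y) : counitFst ℂ A (y ⊗ₜ 1) = 0 := by
  change TensorProduct.lid ℂ A (counit y ⊗ₜ 1) = 0
  rw [hy.counit_eq_zero, TensorProduct.zero_tmul, map_zero]

theorem counitSnd_one_tmul (hy : IsPrimitive y) : counitSnd ℂ A (1 ⊗ₜ y) = 0 := by
  change TensorProduct.rid ℂ A (1 ⊗ₜ counit y) = 0
  rw [hy.counit_eq_zero, TensorProduct.tmul_zero, map_zero]

end LegMaps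

section Jordanian

open HopfAlgebra

variable {A : Type*} [Ring A] [HopfAlgebra ℂ A]

/-- A pair of primitive elements with `[T, E] = E`. -/
structure IsJordanianPair (T E : A) : Prop where
  primitive_left : IsPrimitive T
  primitive_right : IsPrimitive E
  weight : HasWeight T 1 E

/-- The series `(1 - 1 ⊗ E t)^{-T ⊗ 1}`; the twist is its inverse `jordanian (-T) E`. -/
def jordanian (T E : A) : (A ⊗[ℂ] A)⟦X⟧ := negPow (T ⊗ₜ[ℂ] 1) (1 ⊗ₜ[ℂ] E)

theorem jordanian_neg (T E : A) : jordanian (-T) E = negPow (-(T ⊗ₜ[ℂ] 1)) (1 ⊗ₜ[ℂ] E) := by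
  rw [jordanian, TensorProduct.neg_tmul]

theorem jordanian_eq_egf (T E : A) :
    jordanian T E = egf fun j => rise T 0 j ⊗ₜ[ℂ] (E ^ j) := by
  rw [jordanian, negPow]
  congr 1
  funext j
  rw [Algebra.TensorProduct.tmul_pow, one_pow,
    show rise (T ⊗ₜ[ℂ] (1 : A)) 0 j = rise T 0 j ⊗ₜ 1 from
      (map_rise Algebra.TensorProduct.includeLeft T 0 j).symm,
    Algebra.TensorProduct.tmul_mul_tmul, mul_one, one_mul]

theorem commute_tmul (x y : A) : Commute (x ⊗ₜ[ℂ] (1 : A)) (1 ⊗ₜ[ℂ] y) := by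
  simp [Commute, SemiconjBy]

theorem bilin_one_left_egf (β : A →ₗ[ℂ] A ⊗[ℂ] A →ₗ[ℂ] A) (p : ℕ → A ⊗[ℂ] A) :
    bilin β 1 (egf p) = egf fun j => β 1 (p j) := by
  have bilin_eq (z : (A ⊗[ℂ] A)⟦X⟧) : bilin β 1 z = mapCoeff (β 1) z := by
    apply IsXLinear.ext z
    intro w
    rw [← map_one C, bilin_C_C, mapCoeff_C]
  rw [bilin_eq]
  ext N
  rw [mapCoeff, coeff_mk, coeff_egf, coeff_egf, map_smul]

namespace IsJordanianPair

variable {T E y : A} {r : ℂ} (h : IsJordanianPair T E)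

include h

theorem antipodeSnd_jordanian_neg :
    antipodeSnd 1 (jordanian (-T) E) = egf fun j => (T * E) ^ j := by
  rw [antipodeSnd, jordanian_eq_egf, bilin_one_left_egf]
  congr 1
  funext j
  rw [sandwich_tmul, LinearMap.id_apply, mul_one, antipode_pow, h.primitive_right.antipode_eq_neg,
    h.weight.neg.rise_neg_mul_pow, mul_neg, neg_neg]

theorem antipodeFst_jordanian :
    antipodeFst 1 (jordanian T E) = egf fun j => (-(T * E)) ^ j := by
  rw [antipodeFst, jordanian_eq_egf, bilin_one_left_egf]
  congr 1
  funext j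
  rw [sandwich_tmul, LinearMap.id_apply, mul_one, h.primitive_left.antipode_rise,
    h.weight.rise_neg_mul_pow]

theorem cocycle :
    mapAlgHom (comulFst ℂ A) (jordanian T E) * mapAlgHom (legs12 ℂ A) (jordanian T E) =
      mapAlgHom (comulSnd ℂ A) (jordanian T E) * mapAlgHom (legs23 ℂ A) (jordanian T E) := by
  have weight : HasWeight ((1 : A) ⊗ₜ[ℂ] (T ⊗ₜ[ℂ] (1 : A))) 1 (1 ⊗ₜ (E ⊗ₜ 1)) := by
    have hTE := h.weight
    rw [HasWeight] at hTE
    simp [HasWeight, hTE, TensorProduct.add_tmul, TensorProduct.tmul_add]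
  simp only [jordanian, mapAlgHom_negPow, comulFst_tmul_one h.primitive_left, comulFst_one_tmul,
    comulSnd_tmul_one, comulSnd_one_tmul h.primitive_right]
  refine negPow_cocycle ?_ ?_ ?_ ?_ ?_ weight
  all_goals simp [Commute, SemiconjBy, legs12]

theorem isTwist : IsTwist (k := ℂ) (jordanian (-T) E) (jordanian T E) where
  mul_inv := by rw [jordanian_neg, jordanian, negPow_neg_mul (commute_tmul T E)]
  inv_mul := by rw [jordanian_neg, jordanian, negPow_mul_neg (commute_tmul T E)]
  cocycle := h.cocycle
  counit_fst := by
    rw [jordanian, mapAlgHom_negPow, counitFst_tmul_one h.primitive_left, negPow_zero_left]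
  counit_snd := by
    rw [jordanian, mapAlgHom_negPow, counitSnd_one_tmul h.primitive_right, negPow_zero_right]
  antipode := by
    rw [h.antipodeSnd_jordanian_neg, h.antipodeFst_jordanian, egf_pow_mul_egf_neg_pow]

/-- The Hopf algebra `A⟦t⟧` twisted by `(1 - 1 ⊗ E t)^{T ⊗ 1}`. -/
def formalHopf : FormalHopf ℂ A := h.isTwist.formalHopf

theorem comul_C (hy : IsPrimitive y) (hw : HasWeight T r y) :
    h.formalHopf.comul (C y) = tens ℂ (C y) (oneSubPow E r) +
      tSum fun l => ((l.factorial : ℂ)⁻¹) • tens ℂ (C (rise T 0 l))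
        (oneSubPow E (-l) * C ((LieAlgebra.ad ℂ A (-E) ^ l) y)) := by
  have weight : HasWeight (T ⊗ₜ[ℂ] (1 : A)) r (y ⊗ₜ 1) := by
    rw [HasWeight] at hw
    simp [HasWeight, hw, TensorProduct.add_tmul, TensorProduct.smul_tmul']
  have conj_left : jordanian (-T) E * C (y ⊗ₜ 1) * jordanian T E =
      tens ℂ (C y) (oneSubPow E r) := by
    rw [jordanian_neg, jordanian,
      negPow_conj_of_hasWeight (commute_tmul T E) (commute_tmul y E).symm weight, tens_C_left,
      mapAlgHom_oneSubPow, Algebra.TensorProduct.includeRight_apply]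
  have conj_right : jordanian (-T) E * C (1 ⊗ₜ y) * jordanian T E =
      tSum fun l => ((l.factorial : ℂ)⁻¹) • tens ℂ (C (rise T 0 l))
        (oneSubPow E (-l) * C ((LieAlgebra.ad ℂ A (-E) ^ l) y)) := by
    rw [jordanian_neg, jordanian,
      negPow_conj_of_commute (commute_tmul T E) (commute_tmul T y)]
    congr 2
    funext l
    rw [tens_C_left, map_mul, mapAlgHom_oneSubPow, mapAlgHom_C, ← ad_pow_map,
      map_neg Algebra.TensorProduct.includeRight, Algebra.TensorProduct.includeRight_apply,
      Algebra.TensorProduct.includeRight_apply, mul_assoc,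
      show rise (T ⊗ₜ[ℂ] (1 : A)) 0 l = rise T 0 l ⊗ₜ 1 from
        (map_rise Algebra.TensorProduct.includeLeft T 0 l).symm]
  refine (h.isTwist.comul_C y).trans ?_
  rw [hy, map_add, mul_add, add_mul, conj_left, conj_right]

theorem antipode_C (hy : IsPrimitive y) (hw : HasWeight T r y) :
    h.formalHopf.antipode (C y) = -tSum fun l => ((l.factorial : ℂ)⁻¹) •
      (oneSubPow E (-r) * C ((LieAlgebra.ad ℂ A E ^ l) y) * C (rise T 1 l)) := by
  have antipodeFst_eq : antipodeFst 1 (jordanian T E) = negPow (-T) E := by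
    simp only [h.antipodeFst_jordanian, negPow, h.weight.rise_neg_mul_pow]
  refine (conjAntipode_C _ _ y).trans ?_
  rw [hy.antipode_eq_neg, map_neg, mul_neg, neg_mul, mul_assoc, antipodeFst_eq,
    h.weight.C_mul_negPow_neg hw, mul_tSum]
  congr 2
  funext l
  rw [mul_smul_comm, ← mul_assoc, ← mul_assoc, ← antipodeFst_eq, h.isTwist.antipode, one_mul,
    map_mul, mul_assoc]

theorem comul_of_three {z₁ z₂ : A} (hy : IsPrimitive y) (hw : HasWeight T r y)
    (h1 : ⁅E, y⁆ = z₁) (h2 : ⁅E, z₁⁆ = z₂) (h3 : ⁅E, z₂⁆ = 0) :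
    h.formalHopf.comul (C y) = tens ℂ (C y) (oneSubPow E r) + (tens ℂ 1 (C y) -
      tens ℂ (C T) (oneSubPow E (-1) * C z₁ * X) +
      (1 / 2 : ℂ) • tens ℂ (rise (C T) 0 2) (oneSubPow E (-2) * C z₂ * X ^ 2)) := by
  rw [h.comul_C hy hw, tSum_eq_of_three fun j => by
    rw [ad_neg_pow, ad_pow_add_three h1 h2 h3, smul_zero, map_zero, mul_zero, tens_zero,
      smul_zero]]
  have tens_mul_X (u v : A⟦X⟧) : tens ℂ u (v * X) = tens ℂ u v * X := by
    simpa only [pow_one] using tens_mul_X_pow u v 1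
  have ad_one : (LieAlgebra.ad ℂ A (-E) ^ 1) y = -z₁ := by
    rw [ad_neg_pow, pow_one, pow_one, LieAlgebra.ad_apply, h1, neg_one_smul]
  have ad_two : (LieAlgebra.ad ℂ A (-E) ^ 2) y = z₂ := by
    rw [ad_neg_pow, ad_pow_two h1 h2, neg_one_sq, one_smul]
  rw [ad_one, ad_two]
  simp [tens_mul_X, tens_mul_X_pow, tens_neg, oneSubPow_zero, rise, sub_eq_add_neg]

theorem antipode_of_three {z₁ z₂ : A} (hy : IsPrimitive y) (hw : HasWeight T r y)
    (h1 : ⁅E, y⁆ = z₁) (h2 : ⁅E, z₁⁆ = z₂) (h3 : ⁅E, z₂⁆ = 0) :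
    h.formalHopf.antipode (C y) = -(oneSubPow E (-r) * C y +
      oneSubPow E (-r) * C z₁ * rise (C T) 1 1 * X +
      (1 / 2 : ℂ) • (oneSubPow E (-r) * C z₂ * rise (C T) 1 2 * X ^ 2)) := by
  rw [h.antipode_C hy hw, tSum_eq_of_three fun j => by
    rw [ad_pow_add_three h1 h2 h3, map_zero, mul_zero, zero_mul, smul_zero]]
  simp [ad_pow_two h1 h2, h1, rise]

theorem comul_of_two {z : A} (hy : IsPrimitive y) (hw : HasWeight T r y)
    (h1 : ⁅E, y⁆ = z) (h2 : ⁅E, z⁆ = 0) :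
    h.formalHopf.comul (C y) = tens ℂ (C y) (oneSubPow E r) + tens ℂ 1 (C y) -
      tens ℂ (C T) (oneSubPow E (-1) * C z * X) := by
  rw [h.comul_of_three hy hw h1 h2 (lie_zero E), map_zero, mul_zero, zero_mul, tens_zero,
    smul_zero, add_zero, add_sub_assoc]

theorem antipode_of_two {z : A} (hy : IsPrimitive y) (hw : HasWeight T r y)
    (h1 : ⁅E, y⁆ = z) (h2 : ⁅E, z⁆ = 0) :
    h.formalHopf.antipode (C y) =
      -(oneSubPow E (-r) * C y) - oneSubPow E (-r) * C z * rise (C T) 1 1 * X := by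
  rw [h.antipode_of_three hy hw h1 h2 (lie_zero E), map_zero, mul_zero, zero_mul, zero_mul,
    smul_zero, add_zero, neg_add, sub_eq_add_neg]

theorem comul_of_lie_eq_smul {c : ℂ} (hy : IsPrimitive y) (hw : HasWeight T 0 y)
    (h1 : ⁅E, y⁆ = c • E) :
    h.formalHopf.comul (C y) = tens ℂ (C y) 1 + tens ℂ 1 (C y) -
      c • tens ℂ (C T) (oneSubPow E (-1) * C E * X) := by
  rw [h.comul_of_two hy hw h1 (by rw [lie_smul, lie_self, smul_zero]), oneSubPow_zero, C_smul,
    mul_smul_comm, smul_mul_assoc, tens_smul]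

theorem antipode_of_lie_eq_smul {c : ℂ} (hy : IsPrimitive y) (hw : HasWeight T 0 y)
    (h1 : ⁅E, y⁆ = c • E) :
    h.formalHopf.antipode (C y) = -C y - c • (C E * rise (C T) 1 1 * X) := by
  rw [h.antipode_of_two hy hw h1 (by rw [lie_smul, lie_self, smul_zero]), neg_zero,
    oneSubPow_zero, one_mul, one_mul, C_smul, smul_mul_assoc, smul_mul_assoc]

theorem C_mul_rise_one : C E * rise (C T) 1 1 = C T * C E := by
  rw [rise_one, map_one, mul_add, mul_one, ← map_mul, ← map_mul, h.weight, one_smul, map_add]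

theorem formalHopf_noncommutative (hE : E ≠ 0) : h.formalHopf.Noncommutative := by
  refine ⟨C T, C E, fun comm => hE ?_⟩
  rw [← map_mul, ← map_mul, h.weight] at comm
  simpa using C_injective comm

theorem formalHopf_noncocommutative (hTE : T ⊗ₜ[ℂ] E ≠ E ⊗ₜ[ℂ] T) :
    h.formalHopf.Noncocommutative := by
  have lie_eq : ⁅E, T⁆ = (-1 : ℂ) • E := by
    rw [Ring.lie_def, h.weight, one_smul, neg_one_smul, sub_add_cancel_left]
  have coeff_comul : coeff 1 (h.formalHopf.comul (C T)) = T ⊗ₜ[ℂ] E := by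
    rw [h.comul_of_lie_eq_smul h.primitive_left (.of_commute (Commute.refl T)) lie_eq,
      oneSubPow_neg_one_mul]
    simp [tens_C_left, tens_one_left_C, mapAlgHom_oneSubPow, coeff_oneSubPow_neg_one]
  refine ⟨C T, fun cocomm => hTE ?_⟩
  have coeff_cocomm := congrArg (coeff 1) cocomm
  rw [mapCoeff, coeff_mk, coeff_comul] at coeff_cocomm
  exact coeff_cocomm.symm

end IsJordanianPair

end Jordanian

/-! ### The Hopf algebra structure of the universal enveloping algebra -/

section Enveloping

open UniversalEnvelopingAlgebra

variable {k L : Type*} [CommRing k] [LieRing L] [LieAlgebra k L]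

theorem enveloping_induction {p : UniversalEnvelopingAlgebra k L → Prop}
    (algebraMap : ∀ r, p (algebraMap k _ r)) (ι : ∀ x, p (ι k x))
    (mul : ∀ a b, p a → p b → p (a * b)) (add : ∀ a b, p a → p b → p (a + b))
    (a : UniversalEnvelopingAlgebra k L) : p a := by
  let K : Subalgebra k (UniversalEnvelopingAlgebra k L) :=
    { carrier := {a | p a}
      mul_mem' := fun {a b} ha hb => mul a b ha hb
      add_mem' := fun {a b} ha hb => add a b ha hb
      algebraMap_mem' := algebraMap }
  let φ : L →ₗ⁅k⁆ K :=
    { toFun := fun x => ⟨UniversalEnvelopingAlgebra.ι k x, ι x⟩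
      map_add' := fun x y => Subtype.ext (map_add _ x y)
      map_smul' := fun c x => Subtype.ext (map_smul _ c x)
      map_lie' := fun {x y} => Subtype.ext (LieHom.map_lie _ x y) }
  have retraction : K.val.comp (lift k φ) = AlgHom.id k _ :=
    hom_ext k (LieHom.ext fun x => congrArg Subtype.val (lift_ι_apply k φ x))
  have lift_val : (lift k φ a : UniversalEnvelopingAlgebra k L) = a :=
    AlgHom.congr_fun retraction a
  exact lift_val ▸ (lift k φ a).2

theorem enveloping_algHom_ext {B : Type*} [Ring B] [Algebra k B]
    {φ ψ : UniversalEnvelopingAlgebra k L →ₐ[k] B} (hι : ∀ x, φ (ι k x) = ψ (ι k x)) : φ = ψ :=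
  hom_ext k (LieHom.ext hι)

variable (k L)

/-- The coproduct of the universal enveloping algebra, for which `L` is primitive. -/
def envelopingComul : UniversalEnvelopingAlgebra k L →ₐ[k]
    UniversalEnvelopingAlgebra k L ⊗[k] UniversalEnvelopingAlgebra k L :=
  lift k
    { toFun := fun x => ι k x ⊗ₜ 1 + 1 ⊗ₜ ι k x
      map_add' := fun x y => by
        rw [map_add, TensorProduct.add_tmul, TensorProduct.tmul_add]; abel
      map_smul' := fun c x => by
        rw [map_smul, TensorProduct.tmul_smul, ← TensorProduct.smul_tmul', ← smul_add]; rfl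
      map_lie' := fun {x y} => by
        rw [LieHom.map_lie, Ring.lie_def, Ring.lie_def]
        simp only [add_mul, mul_add, Algebra.TensorProduct.tmul_mul_tmul, one_mul, mul_one,
          TensorProduct.sub_tmul, TensorProduct.tmul_sub]
        abel }

/-- The counit of the universal enveloping algebra, which annihilates `L`. -/
def envelopingCounit : UniversalEnvelopingAlgebra k L →ₐ[k] k := lift k (0 : L →ₗ⁅k⁆ k)

/-- The antipode of the universal enveloping algebra as an algebra homomorphism to the opposite
algebra. -/
def envelopingAntipodeOp :
    UniversalEnvelopingAlgebra k L →ₐ[k] (UniversalEnvelopingAlgebra k L)ᵐᵒᵖ :=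
  lift k
    { toFun := fun x => MulOpposite.op (-ι k x)
      map_add' := fun x y => by rw [map_add, neg_add, MulOpposite.op_add]
      map_smul' := fun c x => by rw [map_smul, ← smul_neg, MulOpposite.op_smul]; rfl
      map_lie' := fun {x y} => by
        rw [LieHom.map_lie, Ring.lie_def, Ring.lie_def, ← MulOpposite.op_mul,
          ← MulOpposite.op_mul, ← MulOpposite.op_sub, neg_mul_neg, neg_mul_neg, neg_sub] }

/-- The antipode of the universal enveloping algebra, the antihomomorphism equal to `-1` on `L`. -/
def envelopingAntipode : UniversalEnvelopingAlgebra k L →ₗ[k] UniversalEnvelopingAlgebra k L :=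
  (MulOpposite.opLinearEquiv k).symm.toLinearMap ∘ₗ (envelopingAntipodeOp k L).toLinearMap

variable {k L}

theorem envelopingComul_ι (x : L) :
    envelopingComul k L (ι k x) = ι k x ⊗ₜ 1 + 1 ⊗ₜ ι k x := lift_ι_apply _ _ _

theorem envelopingCounit_ι (x : L) : envelopingCounit k L (ι k x) = 0 := lift_ι_apply _ _ _

theorem envelopingAntipode_ι (x : L) : envelopingAntipode k L (ι k x) = -ι k x :=
  congrArg MulOpposite.unop (lift_ι_apply k _ x)

theorem envelopingAntipode_one : envelopingAntipode k L 1 = 1 :=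
  congrArg MulOpposite.unop (map_one (envelopingAntipodeOp k L))

theorem envelopingAntipode_mul (a b : UniversalEnvelopingAlgebra k L) :
    envelopingAntipode k L (a * b) = envelopingAntipode k L b * envelopingAntipode k L a :=
  congrArg MulOpposite.unop (map_mul (envelopingAntipodeOp k L) a b)

instance : Bialgebra k (UniversalEnvelopingAlgebra k L) :=
  Bialgebra.ofAlgHom (envelopingComul k L) (envelopingCounit k L)
    (enveloping_algHom_ext fun x => by
      simp [-ι_apply, envelopingComul_ι, TensorProduct.add_tmul, TensorProduct.tmul_add, add_assoc,
        Algebra.TensorProduct.one_def])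
    (enveloping_algHom_ext fun x => by
      simp [-ι_apply, envelopingComul_ι, envelopingCounit_ι])
    (enveloping_algHom_ext fun x => by
      simp [-ι_apply, envelopingComul_ι, envelopingCounit_ι])

theorem sandwich_algebraMap {A : Type*} [Ring A] [Algebra k A] (φ ψ : A →ₗ[k] A) (c : k)
    (z : A ⊗[k] A) : sandwich φ ψ (algebraMap k A c) z = c • sandwich φ ψ 1 z := by
  rw [Algebra.algebraMap_eq_smul_one, map_smul, LinearMap.smul_apply]

theorem sandwich_comul_algebraMap {A : Type*} [Ring A] [Bialgebra k A] {φ ψ : A →ₗ[k] A}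
    (hφ : φ 1 = 1) (hψ : ψ 1 = 1) (c : k) :
    sandwich φ ψ 1 (Coalgebra.comul (algebraMap k A c)) = algebraMap k A c := by
  rw [Algebra.algebraMap_eq_smul_one, map_smul, Bialgebra.comul_one, map_smul,
    Algebra.TensorProduct.one_def, sandwich_tmul, hφ, hψ, mul_one, mul_one]

theorem sandwich_envelopingAntipode_left (a : UniversalEnvelopingAlgebra k L) :
    sandwich (envelopingAntipode k L) .id 1 (envelopingComul k L a) =
      algebraMap k _ (envelopingCounit k L a) := by
  induction a using enveloping_induction with
  | algebraMap c =>
    exact (sandwich_comul_algebraMap (ψ := .id) (envelopingAntipode_one (L := L)) rfl c).trans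
      (congrArg (algebraMap k _) (AlgHom.commutes (envelopingCounit k L) c).symm)
  | ι x =>
    rw [envelopingComul_ι, envelopingCounit_ι, map_add, sandwich_tmul, sandwich_tmul,
      envelopingAntipode_ι, envelopingAntipode_one, LinearMap.id_apply, LinearMap.id_apply, mul_one,
      mul_one, mul_one, one_mul, neg_add_cancel, map_zero]
  | mul a b ha hb =>
    rw [map_mul, sandwich_mul_of_antihom_left envelopingAntipode_mul (fun _ _ => rfl), ha,
      sandwich_algebraMap, hb, map_mul, map_mul, Algebra.smul_def]
  | add a b ha hb => rw [map_add, map_add, ha, hb, map_add, map_add]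

theorem sandwich_envelopingAntipode_right (a : UniversalEnvelopingAlgebra k L) :
    sandwich .id (envelopingAntipode k L) 1 (envelopingComul k L a) =
      algebraMap k _ (envelopingCounit k L a) := by
  induction a using enveloping_induction with
  | algebraMap c =>
    exact (sandwich_comul_algebraMap (φ := .id) rfl (envelopingAntipode_one (L := L)) c).trans
      (congrArg (algebraMap k _) (AlgHom.commutes (envelopingCounit k L) c).symm)
  | ι x =>
    rw [envelopingComul_ι, envelopingCounit_ι, map_add, sandwich_tmul, sandwich_tmul,
      envelopingAntipode_ι, envelopingAntipode_one, LinearMap.id_apply, LinearMap.id_apply, mul_one,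
      mul_one, mul_one, one_mul, add_neg_cancel, map_zero]
  | mul a b ha hb =>
    rw [map_mul, sandwich_mul_of_antihom_right (fun _ _ => rfl) envelopingAntipode_mul, hb,
      sandwich_algebraMap, ha, map_mul, map_mul, Algebra.smul_def, Algebra.commutes]
  | add a b ha hb => rw [map_add, map_add, ha, hb, map_add, map_add]

instance : HopfAlgebra k (UniversalEnvelopingAlgebra k L) where
  antipode := envelopingAntipode k L
  mul_antipode_rTensor_comul := LinearMap.ext fun a =>
    (sandwich_one_id_right _).symm.trans (sandwich_envelopingAntipode_left a)
  mul_antipode_lTensor_comul := LinearMap.ext fun a =>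
    (sandwich_one_id_left _).symm.trans (sandwich_envelopingAntipode_right a)

end Enveloping

section EnvelopingPair

open UniversalEnvelopingAlgebra

variable {L : Type*} [LieRing L] [LieAlgebra ℂ L] {T E y : L}

theorem isPrimitive_ι (x : L) : IsPrimitive (ι ℂ x) := envelopingComul_ι x

theorem hasWeight_ι {r : ℂ} (hy : ⁅T, y⁆ = r • y) : HasWeight (ι ℂ T) r (ι ℂ y) := by
  rw [HasWeight, ← map_smul, ← hy, LieHom.map_lie, Ring.lie_def, add_sub_cancel]

theorem isJordanianPair_ι (hTE : ⁅T, E⁆ = E) : IsJordanianPair (ι ℂ T) (ι ℂ E) where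
  primitive_left := isPrimitive_ι T
  primitive_right := isPrimitive_ι E
  weight := hasWeight_ι (by rw [hTE, one_smul])

theorem ad_ι_pow (E y : L) (l : ℕ) :
    (LieAlgebra.ad ℂ (UniversalEnvelopingAlgebra ℂ L) (ι ℂ E) ^ l) (ι ℂ y) =
      ι ℂ ((LieAlgebra.ad ℂ L E ^ l) y) := by
  induction l with
  | zero => rfl
  | succ l ih =>
    rw [pow_succ', Module.End.mul_apply, ih, pow_succ', Module.End.mul_apply, LieAlgebra.ad_apply,
      LieAlgebra.ad_apply, LieHom.map_lie]

variable (L) in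
/-- The adjoint representation of `L` as a representation of its enveloping algebra; it serves to
tell apart the images of elements of `L` without the Poincaré–Birkhoff–Witt theorem. -/
def adjointRep : UniversalEnvelopingAlgebra ℂ L →ₐ[ℂ] Module.End ℂ L :=
  lift ℂ (LieAlgebra.ad ℂ L)

theorem adjointRep_ι (x y : L) : adjointRep L (ι ℂ x) y = ⁅x, y⁆ := by
  rw [adjointRep, lift_ι_apply, LieAlgebra.ad_apply]

theorem ι_ne_zero (hTE : ⁅T, E⁆ = E) (hE : E ≠ 0) : ι ℂ E ≠ 0 := fun ι_eq_zero => by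
  have lie_eq := adjointRep_ι E T
  rw [ι_eq_zero, map_zero, LinearMap.zero_apply, ← lie_skew, hTE] at lie_eq
  exact hE (neg_eq_zero.mp lie_eq.symm)

theorem ι_tmul_ι_ne (hTE : ⁅T, E⁆ = E) (hE : E ≠ 0) :
    ι ℂ T ⊗ₜ[ℂ] ι ℂ E ≠ ι ℂ E ⊗ₜ[ℂ] ι ℂ T := fun tmul_eq => by
  let evalAtE : UniversalEnvelopingAlgebra ℂ L →ₗ[ℂ] L :=
    LinearMap.applyₗ E ∘ₗ (adjointRep L).toLinearMap
  have evalAtE_T : evalAtE (ι ℂ T) = E := (adjointRep_ι T E).trans hTE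
  have evalAtE_E : evalAtE (ι ℂ E) = 0 := (adjointRep_ι E E).trans (lie_self E)
  obtain ⟨ψ, hψ⟩ := Module.Projective.exists_dual_eq_one ℂ hE
  have contracted := congrArg (fun w => TensorProduct.lid ℂ _ ((ψ ∘ₗ evalAtE).rTensor _ w)) tmul_eq
  simp only [LinearMap.rTensor_tmul, LinearMap.comp_apply, evalAtE_T, evalAtE_E, hψ, map_zero,
    TensorProduct.lid_tmul, one_smul, zero_smul] at contracted
  exact ι_ne_zero hTE hE contracted

end EnvelopingPair

/-! ### Brackets of the extended affine Lie algebra -/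

section Brackets

open QTorus

variable {q : ℂˣ} {a b c : ESL q} {n m : Fin 2 → ℤ}

variable (q) in
/-- The matrix part of an element of the extended affine Lie algebra. -/
def matrixPart : ESL q →ₗ[ℂ] Matrix (Fin 2) (Fin 2) (QTorus q) where
  toFun z := z.left.1
  map_add' _ _ := rfl
  map_smul' _ _ := rfl

variable (q) in
/-- The coordinates of an element of the extended affine Lie algebra along `d₁` and `d₂`. -/
def degreePart : ESL q →ₗ[ℂ] (Fin 2 → ℂ) where
  toFun z := z.right
  map_add' _ _ := rfl
  map_smul' _ _ := rfl

theorem mono_mul_mono (m m' : Fin 2 → ℤ) :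
    mono q m * mono q m' = qp q (m 1 * m' 0) • mono q (m + m') := mulLin_mono m m'

theorem mono_ne_zero (m : Fin 2 → ℤ) : mono q m ≠ 0 :=
  Finsupp.single_ne_zero.mpr one_ne_zero

theorem deg_mono (x : Fin 2 → ℂ) (m : Fin 2 → ℤ) :
    deg q x (mono q m) = (∑ i, x i * (m i : ℂ)) • mono q m := lin_mono _ _

theorem deg_zero : deg q 0 = 0 := by
  simpa only [zero_smul] using deg_smul (q := q) 0 0

theorem deg_one (x : Fin 2 → ℂ) : deg q x 1 = 0 := by
  rw [one_def, deg_mono]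
  simp

theorem g_zero : g q 0 = 0 := dif_pos rfl

theorem h_zero : h q 0 = 0 := dif_pos rfl

theorem degreePart_d : degreePart q (d q) = 0 := rfl

theorem degreePart_dd (i : Fin 2) : degreePart q (dd q i) = Pi.single i 1 := rfl

theorem degreePart_e (m : Fin 2 → ℤ) : degreePart q (e q m) = 0 := rfl

theorem degreePart_f (m : Fin 2 → ℤ) : degreePart q (f q m) = 0 := rfl

theorem degreePart_g (m : Fin 2 → ℤ) : degreePart q (g q m) = 0 := by
  rw [g]
  split_ifs <;> rfl

theorem degreePart_h (m : Fin 2 → ℤ) : degreePart q (h q m) = 0 := by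
  rw [h]
  split_ifs <;> rfl

@[simp] theorem matrixPart_d : matrixPart q (d q) = !![1, 0; 0, -1] := rfl

theorem matrixPart_dd (i : Fin 2) : matrixPart q (dd q i) = 0 := rfl

@[simp] theorem matrixPart_e (m : Fin 2 → ℤ) : matrixPart q (e q m) = !![0, mono q m; 0, 0] := rfl

@[simp] theorem matrixPart_f (m : Fin 2 → ℤ) : matrixPart q (f q m) = !![0, 0; mono q m, 0] := rfl

theorem matrixPart_g (hm : m ≠ 0) : matrixPart q (g q m) = !![mono q m, 0; 0, 0] := by
  rw [g, dif_neg hm]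
  rfl

theorem matrixPart_h (hm : m ≠ 0) : matrixPart q (h q m) = !![0, 0; 0, mono q m] := by
  rw [h, dif_neg hm]
  rfl

theorem f_ne_zero (n : Fin 2 → ℤ) : f q n ≠ 0 := fun f_eq_zero =>
  mono_ne_zero n (congrArg (fun z => matrixPart q z 1 0) f_eq_zero)

theorem h_ne_zero (hn : n ≠ 0) : h q n ≠ 0 := fun h_eq_zero => by
  have entry := congrArg (fun z => matrixPart q z 1 1) h_eq_zero
  simp only [matrixPart_h hn] at entry
  exact mono_ne_zero n entry

theorem matrixPart_lie (a b : ESL q) : matrixPart q ⁅a, b⁆ =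
    matrixPart q a * matrixPart q b - matrixPart q b * matrixPart q a +
      (matrixPart q b).map (deg q (degreePart q a)) -
      (matrixPart q a).map (deg q (degreePart q b)) := rfl

theorem degreePart_lie (a b : ESL q) : degreePart q ⁅a, b⁆ = 0 :=
  funext fun _ => sub_eq_zero.mpr (mul_comm _ _)

theorem lie_eq_of_matrixPart (ha : degreePart q a = 0) (hb : degreePart q b = 0)
    (hc : c ∈ LinearMap.ker (degreePart q))
    (h : matrixPart q a * matrixPart q b - matrixPart q b * matrixPart q a = matrixPart q c) :
    ⁅a, b⁆ = c := by
  have matrixPart_eq : matrixPart q ⁅a, b⁆ = matrixPart q c := by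
    rw [matrixPart_lie, ha, hb, deg_zero, h]
    ext i j
    simp
  exact LieAlgebra.SemiDirectSum.ext (Subtype.ext matrixPart_eq)
    ((degreePart_lie a b).trans (LinearMap.mem_ker.mp hc).symm)

theorem lie_dd_eq_of_matrixPart {i : Fin 2} (hb : degreePart q b = 0)
    (hc : c ∈ LinearMap.ker (degreePart q))
    (h : (matrixPart q b).map (deg q (Pi.single i 1)) = matrixPart q c) : ⁅dd q i, b⁆ = c := by
  have matrixPart_eq : matrixPart q ⁅dd q i, b⁆ = matrixPart q c := by
    rw [matrixPart_lie, hb, deg_zero, degreePart_dd, matrixPart_dd, h]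
    ext i j
    simp
  exact LieAlgebra.SemiDirectSum.ext (Subtype.ext matrixPart_eq)
    ((degreePart_lie _ b).trans (LinearMap.mem_ker.mp hc).symm)

theorem lie_f_f (n m : Fin 2 → ℤ) : ⁅f q n, f q m⁆ = 0 :=
  lie_eq_of_matrixPart (degreePart_f n) (degreePart_f m) (zero_mem _) (by
    rw [map_zero]
    simp)

theorem lie_f_g (n : Fin 2 → ℤ) (hm : m ≠ 0) :
    ⁅f q n, g q m⁆ = qp q (m 0 * n 1) • f q (m + n) :=
  lie_eq_of_matrixPart (degreePart_f n) (degreePart_g m)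
    (Submodule.smul_mem _ _ (degreePart_f _)) (by
      rw [map_smul]
      simp [matrixPart_g hm, mono_mul_mono, add_comm n m, mul_comm (n 1)])

theorem lie_f_h (n : Fin 2 → ℤ) (hm : m ≠ 0) :
    ⁅f q n, h q m⁆ = -(qp q (m 1 * n 0) • f q (m + n)) :=
  lie_eq_of_matrixPart (degreePart_f n) (degreePart_h m)
    (neg_mem (Submodule.smul_mem _ _ (degreePart_f _))) (by
      rw [map_neg, map_smul]
      ext i j
      fin_cases i <;> fin_cases j <;> simp [matrixPart_h hm, mono_mul_mono])

theorem lie_f_e (hmn : m + n ≠ 0) :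
    ⁅f q n, e q m⁆ = qp q (m 0 * n 1) • h q (m + n) - qp q (m 1 * n 0) • g q (m + n) :=
  lie_eq_of_matrixPart (degreePart_f n) (degreePart_e m)
    (sub_mem (Submodule.smul_mem _ _ (degreePart_h _))
      (Submodule.smul_mem _ _ (degreePart_g _))) (by
      rw [map_sub, map_smul, map_smul]
      simp [matrixPart_g hmn, matrixPart_h hmn, mono_mul_mono, add_comm n m, mul_comm (n 1)])

theorem lie_f_e_neg (n : Fin 2 → ℤ) : ⁅f q n, e q (-n)⁆ = -(qp q (-(n 0 * n 1)) • d q) :=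
  lie_eq_of_matrixPart (degreePart_f n) (degreePart_e _)
    (neg_mem (Submodule.smul_mem _ _ degreePart_d)) (by
      rw [map_neg, map_smul]
      simp [mono_mul_mono, one_def, mul_comm (n 1)])

theorem lie_f_d (n : Fin 2 → ℤ) : ⁅f q n, d q⁆ = (2 : ℂ) • f q n :=
  lie_eq_of_matrixPart (degreePart_f n) degreePart_d (Submodule.smul_mem _ _ (degreePart_f _)) (by
    rw [map_smul]
    ext i j
    fin_cases i <;> fin_cases j <;> simp [two_smul ℂ])

theorem lie_h_e (m : Fin 2 → ℤ) (hn : n ≠ 0) :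
    ⁅h q n, e q m⁆ = -(qp q (n 0 * m 1) • e q (m + n)) :=
  lie_eq_of_matrixPart (degreePart_h n) (degreePart_e m)
    (neg_mem (Submodule.smul_mem _ _ (degreePart_e _))) (by
      rw [map_neg, map_smul]
      ext i j
      fin_cases i <;> fin_cases j <;> simp [matrixPart_h hn, mono_mul_mono, mul_comm (n 0)])

theorem lie_h_f (m : Fin 2 → ℤ) (hn : n ≠ 0) :
    ⁅h q n, f q m⁆ = qp q (n 1 * m 0) • f q (m + n) := by
  rw [← lie_skew, lie_f_h m hn, neg_neg, add_comm]

theorem lie_h_g (n m : Fin 2 → ℤ) : ⁅h q n, g q m⁆ = 0 := by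
  by_cases hn : n = 0
  · rw [hn, h_zero, zero_lie]
  by_cases hm : m = 0
  · rw [hm, g_zero, lie_zero]
  refine lie_eq_of_matrixPart (degreePart_h n) (degreePart_g m) (zero_mem _) ?_
  rw [map_zero]
  ext i j
  fin_cases i <;> fin_cases j <;> simp [matrixPart_g hm, matrixPart_h hn]

theorem lie_h_h (n m : Fin 2 → ℤ) :
    ⁅h q n, h q m⁆ = (qp q (n 1 * m 0) - qp q (n 0 * m 1)) • h q (m + n) := by
  by_cases hn : n = 0
  · rw [hn, h_zero, zero_lie]
    simp only [Pi.zero_apply, zero_mul, sub_self, zero_smul]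
  by_cases hm : m = 0
  · rw [hm, h_zero, lie_zero]
    simp only [Pi.zero_apply, mul_zero, sub_self, zero_smul]
  refine lie_eq_of_matrixPart (degreePart_h n) (degreePart_h m)
    (Submodule.smul_mem _ _ (degreePart_h _)) ?_
  rw [map_smul, matrixPart_h hm, matrixPart_h hn]
  by_cases hmn : m + n = 0
  · obtain rfl : m = -n := eq_neg_of_add_eq_zero_left hmn
    rw [neg_add_cancel, h_zero, map_zero]
    ext i j
    fin_cases i <;> fin_cases j <;> simp [mono_mul_mono, mul_comm]
  · ext i j
    fin_cases i <;> fin_cases j <;>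
      simp [matrixPart_h hmn, mono_mul_mono, mul_comm (n 0), sub_smul, add_comm n m]

theorem lie_h_d (n : Fin 2 → ℤ) : ⁅h q n, d q⁆ = 0 := by
  by_cases hn : n = 0
  · rw [hn, h_zero, zero_lie]
  refine lie_eq_of_matrixPart (degreePart_h n) degreePart_d (zero_mem _) ?_
  rw [map_zero]
  ext i j
  fin_cases i <;> fin_cases j <;> simp [matrixPart_h hn]

theorem lie_d_e (m : Fin 2 → ℤ) : ⁅d q, e q m⁆ = (2 : ℂ) • e q m :=
  lie_eq_of_matrixPart degreePart_d (degreePart_e m) (Submodule.smul_mem _ _ (degreePart_e _)) (by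
    rw [map_smul]
    ext i j
    fin_cases i <;> fin_cases j <;> simp [two_smul ℂ])

theorem lie_d_f (m : Fin 2 → ℤ) : ⁅d q, f q m⁆ = (-2 : ℂ) • f q m := by
  rw [← lie_skew, lie_f_d, neg_smul]

theorem lie_d_g (m : Fin 2 → ℤ) : ⁅d q, g q m⁆ = 0 := by
  by_cases hm : m = 0
  · rw [hm, g_zero, lie_zero]
  refine lie_eq_of_matrixPart degreePart_d (degreePart_g m) (zero_mem _) ?_
  rw [map_zero]
  ext i j
  fin_cases i <;> fin_cases j <;> simp [matrixPart_g hm]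

theorem lie_d_h (m : Fin 2 → ℤ) : ⁅d q, h q m⁆ = 0 := by
  rw [← lie_skew, lie_h_d, neg_zero]

theorem lie_dd_d (i : Fin 2) : ⁅dd q i, d q⁆ = 0 :=
  lie_dd_eq_of_matrixPart degreePart_d (zero_mem _) (by
    rw [map_zero]
    ext j k
    fin_cases j <;> fin_cases k <;> simp [deg_one])

theorem lie_dd_dd (i j : Fin 2) : ⁅dd q i, dd q j⁆ = 0 := by
  have matrixPart_eq : matrixPart q ⁅dd q i, dd q j⁆ = 0 := by
    rw [matrixPart_lie, matrixPart_dd, matrixPart_dd]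
    ext i j
    simp
  exact LieAlgebra.SemiDirectSum.ext (Subtype.ext matrixPart_eq) (degreePart_lie _ _)

theorem degreePart_letter (y : Letter) (m : Fin 2 → ℤ) : degreePart q (y.elt q m) = 0 := by
  cases y
  · exact degreePart_e m
  · exact degreePart_f m
  · exact degreePart_g m
  · exact degreePart_h m

theorem lie_dd_letter (y : Letter) (m : Fin 2 → ℤ) (i : Fin 2) :
    ⁅dd q i, y.elt q m⁆ = (m i : ℂ) • y.elt q m := by
  refine lie_dd_eq_of_matrixPart (degreePart_letter y m)
    (Submodule.smul_mem _ _ (degreePart_letter y m)) ?_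
  have deg_eq : deg q (Pi.single i 1) (mono q m) = (m i : ℂ) • mono q m := by
    simp [deg_mono, Pi.single_apply]
  have matrixPart_g_zero : matrixPart q (g q 0) = 0 := by rw [g_zero, map_zero]
  have matrixPart_h_zero : matrixPart q (h q 0) = 0 := by rw [h_zero, map_zero]
  rw [map_smul]
  obtain rfl | hm := eq_or_ne m 0
  · ext j k
    cases y <;> fin_cases j <;> fin_cases k <;>
      simp [Letter.elt, deg_eq, matrixPart_g_zero, matrixPart_h_zero]
  · ext j k
    cases y <;> fin_cases j <;> fin_cases k <;>
      simp [Letter.elt, deg_eq, matrixPart_g hm, matrixPart_h hm]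

theorem lie_sum_dd_d (x : Fin 2 → ℂ) : ⁅∑ i, x i • dd q i, d q⁆ = 0 := by
  simp only [sum_lie, smul_lie, lie_dd_d, smul_zero, Finset.sum_const_zero]

theorem lie_sum_dd_dd (x : Fin 2 → ℂ) (j : Fin 2) : ⁅∑ i, x i • dd q i, dd q j⁆ = 0 := by
  simp only [sum_lie, smul_lie, lie_dd_dd, smul_zero, Finset.sum_const_zero]

theorem lie_sum_dd_letter (x : Fin 2 → ℂ) (y : Letter) (m : Fin 2 → ℤ) :
    ⁅∑ i, x i • dd q i, y.elt q m⁆ = (∑ i, x i * (m i : ℂ)) • y.elt q m := by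
  simp only [sum_lie, smul_lie, lie_dd_letter, smul_smul, Finset.sum_smul]

theorem lie_letter_dd (y : Letter) (m : Fin 2 → ℤ) (i : Fin 2) :
    ⁅y.elt q m, dd q i⁆ = (-(m i : ℂ)) • y.elt q m := by
  rw [← lie_skew, lie_dd_letter, neg_smul]

end Brackets

/-! ### The coproduct and the antipode on the basis -/

section Basis

variable {q : ℂˣ} {n m : Fin 2 → ℤ} {s : Letter}

theorem eta_zero (n m : Fin 2 → ℤ) (s : Letter) : eta q n m s 0 = 1 := by
  cases s <;> simp [eta]

theorem eta_succ (n m : Fin 2 → ℤ) (s : Letter) (j : ℕ) :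
    eta q n m s (j + 1) = eta q n m s j * eta q n (m + j • n) s 1 := by
  cases s <;> simp [eta, Finset.prod_range_succ, pow_succ] <;> ring

theorem lie_h_letter (hn : n ≠ 0) (s : Letter) (m : Fin 2 → ℤ) :
    ⁅h q n, s.elt q m⁆ = (-eta q n m s 1) • s.elt q (m + n) := by
  cases s
  · simp [Letter.elt, eta, lie_h_e m hn]
  · simp [Letter.elt, eta, lie_h_f m hn]
  · rw [Letter.elt, lie_h_g, eta, neg_zero, zero_smul]
  · rw [Letter.elt, lie_h_h]
    simp [eta]

theorem ad_h_pow_letter (hn : n ≠ 0) (s : Letter) (m : Fin 2 → ℤ) (j : ℕ) :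
    (LieAlgebra.ad ℂ (ESL q) (h q n) ^ j) (s.elt q m) =
      ((-1) ^ j * eta q n m s j) • s.elt q (m + j • n) := by
  induction j with
  | zero => simp [eta_zero]
  | succ j ih =>
    rw [pow_succ', Module.End.mul_apply, ih, map_smul, LieAlgebra.ad_apply, lie_h_letter hn,
      smul_smul, eta_succ n m s j, succ_nsmul, ← add_assoc]
    congr 1
    ring

theorem lie_f_letter (hs : s ≠ Letter.e) (hm : s.Index m) :
    ⁅f q n, s.elt q m⁆ = (-beta q n m s) • f q (m + n) := by
  cases s with
  | e => exact absurd rfl hs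
  | f => rw [Letter.elt, lie_f_f, beta, neg_zero, zero_smul]
  | g => rw [Letter.elt, lie_f_g _ hm, beta, neg_neg]
  | h => rw [Letter.elt, lie_f_h _ hm, beta, neg_smul]

theorem qp_mul (a b : ℤ) : qp q a * qp q b = qp q (a + b) := by
  rw [qp, qp, qp, ← Units.val_mul, zpow_add]

theorem lie_f_lie_f_e (hm : m + n ≠ 0) :
    ⁅f q n, ⁅f q n, e q m⁆⁆ = (-2 * sCoef q n m) • f q (m + 2 • n) := by
  have exponent_h : m 0 * n 1 + (m 1 + n 1) * n 0 = n 1 * m 0 + n 0 * m 1 + n 0 * n 1 := by ring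
  have exponent_g : m 1 * n 0 + (m 0 + n 0) * n 1 = n 1 * m 0 + n 0 * m 1 + n 0 * n 1 := by ring
  have index : m + n + n = m + 2 • n := by rw [two_smul, add_assoc]
  rw [lie_f_e hm, lie_sub, lie_smul, lie_smul, lie_f_h _ hm, lie_f_g _ hm, smul_neg, smul_smul,
    smul_smul, qp_mul, qp_mul, Pi.add_apply, Pi.add_apply, exponent_h, exponent_g, sCoef,
    index]
  module

theorem lie_f_lie_f_e_neg (n : Fin 2 → ℤ) :
    ⁅f q n, ⁅f q n, e q (-n)⁆⁆ = (-2 * qp q (-(n 0 * n 1))) • f q n := by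
  rw [lie_f_e_neg, lie_neg, lie_smul, lie_f_d]
  module

theorem deltaF_g : deltaF Letter.g = 0 := rfl

theorem deltaF_h : deltaF Letter.h = 0 := rfl

theorem lie_half_d_letter (hs : s ≠ Letter.e) (m : Fin 2 → ℤ) :
    ⁅(-(1 / 2) : ℂ) • d q, s.elt q m⁆ = deltaF s • s.elt q m := by
  cases s with
  | e => exact absurd rfl hs
  | f =>
    rw [Letter.elt, smul_lie, lie_d_f, smul_smul, deltaF]
    norm_num
  | g => rw [Letter.elt, smul_lie, lie_d_g, smul_zero, deltaF_g, zero_smul]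
  | h => rw [Letter.elt, smul_lie, lie_d_h, smul_zero, deltaF_h, zero_smul]

theorem lie_half_d_e (m : Fin 2 → ℤ) : ⁅(-(1 / 2) : ℂ) • d q, e q m⁆ = (-1 : ℂ) • e q m := by
  rw [smul_lie, lie_d_e, smul_smul]
  norm_num

theorem lie_half_d_f (n : Fin 2 → ℤ) : ⁅(-(1 / 2) : ℂ) • d q, f q n⁆ = f q n := by
  rw [smul_lie, lie_d_f, smul_smul]
  norm_num

theorem lie_half_d_h (m : Fin 2 → ℤ) : ⁅(-(1 / 2) : ℂ) • d q, h q m⁆ = 0 := by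
  rw [smul_lie, lie_d_h, smul_zero]

theorem lie_half_d_d : ⁅(-(1 / 2) : ℂ) • d q, d q⁆ = 0 := by rw [smul_lie, lie_self, smul_zero]

theorem lie_half_d_dd (i : Fin 2) : ⁅(-(1 / 2) : ℂ) • d q, dd q i⁆ = 0 := by
  rw [smul_lie, ← lie_skew, lie_dd_d, neg_zero, smul_zero]

theorem lie_sum_dd_e_neg {x : Fin 2 → ℂ} (hx : ⁅∑ i, x i • dd q i, f q n⁆ = f q n) :
    ⁅∑ i, x i • dd q i, e q (-n)⁆ = (-1 : ℂ) • e q (-n) := by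
  have weight_f : ∑ i, x i * (n i : ℂ) = 1 := by
    refine smul_left_injective ℂ (f_ne_zero (q := q) n) ?_
    exact ((lie_sum_dd_letter x .f n).symm.trans hx).trans (one_smul ℂ _).symm
  refine (lie_sum_dd_letter x .e (-n)).trans (congrArg (· • e q (-n)) ?_)
  simp only [Pi.neg_apply, Int.cast_neg, mul_neg, Finset.sum_neg_distrib, weight_f]

end Basis

section Twisted

open UniversalEnvelopingAlgebra

variable {q : ℂˣ} {T E y z₁ z₂ : ESL q} {n m : Fin 2 → ℤ} {r c : ℂ} {s : Letter}

/-- The Hopf algebra structure on `U⟦t⟧` twisted by `(1 - 1 ⊗ E t)^{T ⊗ 1}`. -/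
def jordanianHopf (hTE : ⁅T, E⁆ = E) : FormalHopf ℂ (U q) := (isJordanianPair_ι hTE).formalHopf

theorem lie_ι {x y z : ESL q} (hxy : ⁅x, y⁆ = z) : ⁅ι ℂ x, ι ℂ y⁆ = ι ℂ z := by
  rw [← LieHom.map_lie, hxy]

theorem emb_smul (c : ℂ) (z : ESL q) : emb (c • z) = c • emb z := by
  rw [emb, toU, map_smul, C_smul, emb, toU]

theorem emb_neg (z : ESL q) : emb (-z) = -emb z := by
  rw [emb, toU, map_neg, map_neg, emb, toU]

theorem emb_sub (z w : ESL q) : emb (z - w) = emb z - emb w := by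
  rw [emb, toU, map_sub, map_sub, emb, emb, toU, toU]

theorem pw_zero (E : ESL q) : pw E 0 = 1 := oneSubPow_zero _

theorem commute_rise_emb (hy : ⁅T, y⁆ = 0) (a : ℂ) (j : ℕ) :
    Commute (rise (emb T) a j) (emb y) := by
  have toU_comm : toU T * toU y = toU y * toU T := by
    have weight : HasWeight (toU T) 0 (toU y) := hasWeight_ι (by rw [hy, zero_smul])
    rwa [HasWeight, zero_smul, add_zero] at weight
  refine commute_rise ?_ a j
  rw [Commute, SemiconjBy, emb, emb, ← map_mul, ← map_mul, toU_comm]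

variable (hTE : ⁅T, E⁆ = E)

theorem jordanianHopf_noncommutative (hE : E ≠ 0) : (jordanianHopf hTE).Noncommutative :=
  (isJordanianPair_ι hTE).formalHopf_noncommutative (ι_ne_zero hTE hE)

theorem jordanianHopf_noncocommutative (hE : E ≠ 0) : (jordanianHopf hTE).Noncocommutative :=
  (isJordanianPair_ι hTE).formalHopf_noncocommutative (ι_tmul_ι_ne hTE hE)

theorem jordanianHopf_counit (a : (U q)⟦X⟧) :
    (jordanianHopf hTE).counit a = PowerSeries.map (counitU q).toRingHom a := rfl

theorem comul_emb_of_two (hr : ⁅T, y⁆ = r • y) (h1 : ⁅E, y⁆ = z₁) (h2 : ⁅E, z₁⁆ = 0) :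
    (jordanianHopf hTE).comul (emb y) =
      emb y ⊠ pw E r + 1 ⊠ emb y - emb T ⊠ pw E (-1) * emb z₁ * X :=
  (isJordanianPair_ι hTE).comul_of_two (isPrimitive_ι y) (hasWeight_ι hr) (lie_ι h1)
    ((lie_ι h2).trans (map_zero _))

theorem antipode_emb_of_two (hr : ⁅T, y⁆ = r • y) (h1 : ⁅E, y⁆ = z₁) (h2 : ⁅E, z₁⁆ = 0) :
    (jordanianHopf hTE).antipode (emb y) =
      -(pw E (-r) * emb y) - pw E (-r) * emb z₁ * rise (emb T) 1 1 * X :=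
  (isJordanianPair_ι hTE).antipode_of_two (isPrimitive_ι y) (hasWeight_ι hr) (lie_ι h1)
    ((lie_ι h2).trans (map_zero _))

theorem comul_emb_of_three (hr : ⁅T, y⁆ = r • y) (h1 : ⁅E, y⁆ = z₁) (h2 : ⁅E, z₁⁆ = z₂)
    (h3 : ⁅E, z₂⁆ = 0) :
    (jordanianHopf hTE).comul (emb y) = emb y ⊠ pw E r + (1 ⊠ emb y -
      emb T ⊠ pw E (-1) * emb z₁ * X +
      (1 / 2 : ℂ) • (rise (emb T) 0 2 ⊠ pw E (-2) * emb z₂ * X ^ 2)) :=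
  (isJordanianPair_ι hTE).comul_of_three (isPrimitive_ι y) (hasWeight_ι hr) (lie_ι h1) (lie_ι h2)
    ((lie_ι h3).trans (map_zero _))

theorem antipode_emb_of_three (hr : ⁅T, y⁆ = r • y) (h1 : ⁅E, y⁆ = z₁) (h2 : ⁅E, z₁⁆ = z₂)
    (h3 : ⁅E, z₂⁆ = 0) :
    (jordanianHopf hTE).antipode (emb y) = -(pw E (-r) * emb y +
      pw E (-r) * emb z₁ * rise (emb T) 1 1 * X +
      (1 / 2 : ℂ) • (pw E (-r) * emb z₂ * rise (emb T) 1 2 * X ^ 2)) :=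
  (isJordanianPair_ι hTE).antipode_of_three (isPrimitive_ι y) (hasWeight_ι hr) (lie_ι h1)
    (lie_ι h2) ((lie_ι h3).trans (map_zero _))

theorem comul_emb_of_lie_eq_smul (hy : ⁅T, y⁆ = 0) (h1 : ⁅E, y⁆ = c • E) :
    (jordanianHopf hTE).comul (emb y) =
      emb y ⊠ 1 + 1 ⊠ emb y - c • (emb T ⊠ pw E (-1) * emb E * X) :=
  (isJordanianPair_ι hTE).comul_of_lie_eq_smul (isPrimitive_ι y)
    (hasWeight_ι (hy.trans (zero_smul ℂ y).symm)) ((lie_ι h1).trans (map_smul (ι ℂ) c E))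

theorem antipode_emb_of_lie_eq_smul (hy : ⁅T, y⁆ = 0) (h1 : ⁅E, y⁆ = c • E) :
    (jordanianHopf hTE).antipode (emb y) =
      -emb y - c • (emb E * rise (emb T) 1 1 * X) :=
  (isJordanianPair_ι hTE).antipode_of_lie_eq_smul (isPrimitive_ι y)
    (hasWeight_ι (hy.trans (zero_smul ℂ y).symm)) ((lie_ι h1).trans (map_smul (ι ℂ) c E))

theorem comul_emb_of_lie_eq_neg_smul (hy : ⁅T, y⁆ = 0) (h1 : ⁅E, y⁆ = (-c) • E) :
    (jordanianHopf hTE).comul (emb y) =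
      emb y ⊠ 1 + 1 ⊠ emb y - c • (emb T ⊠ 1) + c • (emb T ⊠ pw E (-1)) := by
  have pw_mul : pw E (-1) * emb E * X = pw E (-1) - 1 := oneSubPow_neg_one_mul _
  rw [comul_emb_of_lie_eq_smul hTE hy h1, pw_mul, ot, ot, ot, ot, ot, tens_sub]
  module

theorem antipode_emb_of_lie_eq_neg_smul (hy : ⁅T, y⁆ = 0) (h1 : ⁅E, y⁆ = (-c) • E) :
    (jordanianHopf hTE).antipode (emb y) = -emb y + c • (emb T * emb E * X) := by
  have rise_swap : emb E * rise (emb T) 1 1 = emb T * emb E :=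
    (isJordanianPair_ι hTE).C_mul_rise_one
  rw [antipode_emb_of_lie_eq_smul hTE hy h1, rise_swap, neg_smul, sub_neg_eq_add]

theorem comul_antipode_dd_of_letter (i : Fin 2) (hE : E = s.elt q n) (hT : ⁅T, dd q i⁆ = 0) :
    (jordanianHopf hTE).comul (emb (dd q i)) = emb (dd q i) ⊠ 1 + 1 ⊠ emb (dd q i) -
      (n i : ℂ) • (emb T ⊠ 1) + (n i : ℂ) • (emb T ⊠ pw E (-1)) ∧
    (jordanianHopf hTE).antipode (emb (dd q i)) =
      -emb (dd q i) + (n i : ℂ) • (emb T * emb E * X) := by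
  subst hE
  exact ⟨comul_emb_of_lie_eq_neg_smul hTE hT (lie_letter_dd s n i),
    antipode_emb_of_lie_eq_neg_smul hTE hT (lie_letter_dd s n i)⟩

end Twisted

section UpperImaginary

variable {q : ℂˣ} {T : ESL q} {n : Fin 2 → ℤ} {r : ℂ} (hTE : ⁅T, h q n⁆ = h q n)

theorem comul_letter_of_h (hn : n ≠ 0) (y : Letter) (m : Fin 2 → ℤ)
    (hr : ⁅T, y.elt q m⁆ = r • y.elt q m) :
    (jordanianHopf hTE).comul (emb (y.elt q m)) =
      emb (y.elt q m) ⊠ pw (h q n) r + tSum fun j => (eta q n m y j / (j.factorial : ℂ)) •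
        (rise (emb T) 0 j ⊠ pw (h q n) (-(j : ℂ)) * emb (y.elt q (m + j • n))) := by
  refine ((isJordanianPair_ι hTE).comul_C (isPrimitive_ι _) (hasWeight_ι hr)).trans ?_
  refine congrArg (_ + tSum ·) (funext fun j => ?_)
  have sign : (-1 : ℂ) ^ j * ((-1) ^ j * eta q n m y j) = eta q n m y j := by
    rw [← mul_assoc, ← mul_pow, neg_one_mul, neg_neg, one_pow, one_mul]
  rw [ad_neg_pow, ad_ι_pow, ad_h_pow_letter hn, map_smul (UniversalEnvelopingAlgebra.ι ℂ),
    smul_smul, sign, C_smul, mul_smul_comm, tens_smul, smul_smul, C_rise, inv_mul_eq_div]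
  rfl

theorem antipode_letter_of_h (hn : n ≠ 0) (y : Letter) (m : Fin 2 → ℤ)
    (hr : ⁅T, y.elt q m⁆ = r • y.elt q m) :
    (jordanianHopf hTE).antipode (emb (y.elt q m)) =
      tSum fun j => ((-1) ^ (j + 1) * eta q n m y j / (j.factorial : ℂ)) •
        (pw (h q n) (-r) * emb (y.elt q (m + j • n)) * rise (emb T) 1 j) := by
  refine ((isJordanianPair_ι hTE).antipode_C (isPrimitive_ι _) (hasWeight_ι hr)).trans ?_
  rw [← neg_one_mul, mul_tSum]
  refine congrArg tSum (funext fun j => ?_)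
  rw [ad_ι_pow, ad_h_pow_letter hn, map_smul (UniversalEnvelopingAlgebra.ι ℂ), C_smul,
    neg_one_mul, mul_smul_comm, smul_mul_assoc, smul_smul, ← neg_smul, C_rise]
  refine congrArg₂ (· • ·) ?_ rfl
  ring

theorem comul_d_of_h (hTd : ⁅T, d q⁆ = 0) :
    (jordanianHopf hTE).comul (emb (d q)) = emb (d q) ⊠ 1 + 1 ⊠ emb (d q) := by
  rw [comul_emb_of_lie_eq_smul hTE hTd (c := 0) (by rw [lie_h_d, zero_smul]), zero_smul, sub_zero]

theorem antipode_d_of_h (hTd : ⁅T, d q⁆ = 0) :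
    (jordanianHopf hTE).antipode (emb (d q)) = -emb (d q) := by
  rw [antipode_emb_of_lie_eq_smul hTE hTd (c := 0) (by rw [lie_h_d, zero_smul]), zero_smul,
    sub_zero]

end UpperImaginary

section Lowering

variable {q : ℂˣ} {T : ESL q} {n m : Fin 2 → ℤ} {r : ℂ} {y : Letter} (hTE : ⁅T, f q n⁆ = f q n)

theorem comul_letter_of_f (hy : y ≠ Letter.e) (hm : y.Index m)
    (hr : ⁅T, y.elt q m⁆ = r • y.elt q m) :
    (jordanianHopf hTE).comul (emb (y.elt q m)) =
      emb (y.elt q m) ⊠ pw (f q n) r + 1 ⊠ emb (y.elt q m)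
        + beta q n m y • (emb T ⊠ pw (f q n) (-1) * emb (f q (m + n)) * X) := by
  rw [comul_emb_of_two hTE hr (lie_f_letter hy hm) (by rw [lie_smul, lie_f_f, smul_zero])]
  simp only [emb_smul, mul_smul_comm, smul_mul_assoc, ot, tens_smul]
  module

theorem antipode_letter_of_f (hy : y ≠ Letter.e) (hm : y.Index m)
    (hr : ⁅T, y.elt q m⁆ = r • y.elt q m) :
    (jordanianHopf hTE).antipode (emb (y.elt q m)) = -(pw (f q n) (-r) * emb (y.elt q m))
      + beta q n m y • (pw (f q n) (-r) * emb (f q (m + n)) * rise (emb T) 1 1 * X) := by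
  rw [antipode_emb_of_two hTE hr (lie_f_letter hy hm) (by rw [lie_smul, lie_f_f, smul_zero])]
  simp only [emb_smul, mul_smul_comm, smul_mul_assoc]
  module

theorem comul_e_of_f (hm : m + n ≠ 0) (hr : ⁅T, e q m⁆ = r • e q m) :
    (jordanianHopf hTE).comul (emb (e q m)) =
      qp q (m 1 * n 0) • (emb T ⊠ pw (f q n) (-1) * emb (g q (m + n)) * X)
        - qp q (m 0 * n 1) • (emb T ⊠ pw (f q n) (-1) * emb (h q (m + n)) * X)
        + emb (e q m) ⊠ pw (f q n) r + 1 ⊠ emb (e q m)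
        - sCoef q n m • (rise (emb T) 0 2 ⊠
          pw (f q n) (-2) * emb (f q (m + 2 • n)) * X ^ 2) := by
  rw [comul_emb_of_three hTE hr rfl (lie_f_lie_f_e hm) (by rw [lie_smul, lie_f_f, smul_zero]),
    lie_f_e hm]
  simp only [emb_smul, emb_sub, mul_smul_comm, smul_mul_assoc, mul_sub, sub_mul, ot, tens_smul,
    tens_sub]
  module

theorem antipode_e_of_f (hm : m + n ≠ 0) (hr : ⁅T, e q m⁆ = r • e q m) :
    (jordanianHopf hTE).antipode (emb (e q m)) =
      qp q (m 1 * n 0) • (pw (f q n) (-r) * emb (g q (m + n)) * rise (emb T) 1 1 * X)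
        - qp q (m 0 * n 1) • (pw (f q n) (-r) * emb (h q (m + n)) * rise (emb T) 1 1 * X)
        - pw (f q n) (-r) * emb (e q m)
        + sCoef q n m • (pw (f q n) (-r) * emb (f q (m + 2 • n)) *
          rise (emb T) 1 2 * X ^ 2) := by
  rw [antipode_emb_of_three hTE hr rfl (lie_f_lie_f_e hm) (by rw [lie_smul, lie_f_f, smul_zero]),
    lie_f_e hm]
  simp only [emb_smul, emb_sub, mul_smul_comm, smul_mul_assoc, mul_sub, sub_mul]
  module

theorem comul_e_neg_of_f (hr : ⁅T, e q (-n)⁆ = (-1 : ℂ) • e q (-n)) :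
    (jordanianHopf hTE).comul (emb (e q (-n))) =
      emb (e q (-n)) ⊠ pw (f q n) (-1) + 1 ⊠ emb (e q (-n))
        + qp q (-(n 1 * n 0)) • (emb T ⊠ pw (f q n) (-1) * emb (d q) * X)
        - qp q (-(n 0 * n 1)) • (rise (emb T) 0 2 ⊠
          pw (f q n) (-2) * emb (f q n) * X ^ 2) := by
  rw [comul_emb_of_three hTE hr rfl (lie_f_lie_f_e_neg n)
    (by rw [lie_smul, lie_self, smul_zero]), lie_f_e_neg, mul_comm (n 0)]
  simp only [emb_smul, emb_neg, mul_smul_comm, smul_mul_assoc, mul_neg, neg_mul, ot, tens_smul,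
    tens_neg]
  module

theorem antipode_e_neg_of_f (hr : ⁅T, e q (-n)⁆ = (-1 : ℂ) • e q (-n)) :
    (jordanianHopf hTE).antipode (emb (e q (-n))) =
      qp q (-(n 0 * n 1)) • (pw (f q n) 1 * emb (f q n) * rise (emb T) 1 2 * X ^ 2)
        - pw (f q n) 1 * emb (e q (-n))
        + qp q (-(n 0 * n 1)) • (pw (f q n) 1 * emb (d q) * rise (emb T) 1 1 * X) := by
  rw [antipode_emb_of_three hTE hr rfl (lie_f_lie_f_e_neg n)
    (by rw [lie_smul, lie_self, smul_zero]), lie_f_e_neg, neg_neg]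
  simp only [emb_smul, emb_neg, mul_smul_comm, smul_mul_assoc, mul_neg, neg_mul]
  module

end Lowering

section HalfCartan

variable {q : ℂˣ} {T : ESL q} {n m : Fin 2 → ℤ} {y : Letter} (hTE : ⁅T, f q n⁆ = f q n)

theorem antipode_letter_of_f_of_deltaF (hy : y ≠ Letter.e) (hm : y.Index m)
    (hr : ⁅T, y.elt q m⁆ = deltaF y • y.elt q m) :
    (jordanianHopf hTE).antipode (emb (y.elt q m)) =
      -(pw (f q n) (-deltaF y) * emb (y.elt q m))
        + beta q n m y • (emb (f q (m + n)) * rise (emb T) 1 1 * X) := by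
  rw [antipode_letter_of_f hTE hy hm hr]
  cases y with
  | e => exact absurd rfl hy
  | f => rw [beta, zero_smul, zero_smul]
  | g => rw [deltaF_g, neg_zero, pw_zero, one_mul, one_mul]
  | h => rw [deltaF_h, neg_zero, pw_zero, one_mul, one_mul]

theorem antipode_e_of_f_of_lie_h (hm : m + n ≠ 0) (hr : ⁅T, e q m⁆ = (-1 : ℂ) • e q m)
    (hTh : ⁅T, h q (m + n)⁆ = 0) :
    (jordanianHopf hTE).antipode (emb (e q m)) =
      qp q (m 1 * n 0) • (pw (f q n) 1 * emb (g q (m + n)) * rise (emb T) 1 1 * X)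
        - qp q (m 0 * n 1) • (pw (f q n) 1 * rise (emb T) 1 1 * emb (h q (m + n)) * X)
        - pw (f q n) 1 * emb (e q m)
        + sCoef q n m • (pw (f q n) 1 * emb (f q (m + 2 • n)) * rise (emb T) 1 2 * X ^ 2) := by
  rw [antipode_e_of_f hTE hm hr, neg_neg, mul_assoc (pw (f q n) 1) (rise _ _ _),
    (commute_rise_emb hTh 1 1).eq, ← mul_assoc]

end HalfCartan

end EALA

end

theorem corollary1p2 (q : ℂˣ) :
    -- `T = x₁ d₁ + x₂ d₂`, `E = h_n`
    (∀ (n : Fin 2 → ℤ) (x : Fin 2 → ℂ) (T E : ESL q), n ≠ 0 →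
      T = ∑ i, x i • dd q i → E = h q n → ⁅T, E⁆ = E →
      ∃ H : FormalHopf ℂ (U q),
        H.Noncommutative ∧ H.Noncocommutative ∧
        (∀ a, H.counit a = PowerSeries.map (counitU q).toRingHom a) ∧
        (∀ (y : Letter) (m : Fin 2 → ℤ) (r : ℂ), y.Index m → r = ∑ i, x i * (m i : ℂ) →
          H.comul (emb (y.elt q m)) =
            emb (y.elt q m) ⊠ pw E r +
              tSum (fun j => (eta q n m y j / (j.factorial : ℂ)) •
                (rise (emb T) 0 j ⊠
                  pw E (-(j : ℂ)) * emb (y.elt q (m + j • n)))) ∧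
          H.antipode (emb (y.elt q m)) =
            tSum (fun j => ((-1) ^ (j + 1) * eta q n m y j / (j.factorial : ℂ)) •
              (pw E (-r) * emb (y.elt q (m + j • n)) *
                rise (emb T) 1 j))) ∧
        (∀ i : Fin 2,
          H.comul (emb (dd q i)) =
            emb (dd q i) ⊠ 1 + 1 ⊠ emb (dd q i)
              - (n i : ℂ) • (emb T ⊠ 1) + (n i : ℂ) • (emb T ⊠ pw E (-1)) ∧
          H.antipode (emb (dd q i)) =
            -emb (dd q i) + (n i : ℂ) • (emb T * emb E * X)) ∧
        H.comul (emb (d q)) = emb (d q) ⊠ 1 + 1 ⊠ emb (d q) ∧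
        H.antipode (emb (d q)) = -emb (d q)) ∧
    -- `T = x₁ d₁ + x₂ d₂`, `E = f_n`
    (∀ (n : Fin 2 → ℤ) (x : Fin 2 → ℂ) (T E : ESL q),
      T = ∑ i, x i • dd q i → E = f q n → ⁅T, E⁆ = E →
      ∃ H : FormalHopf ℂ (U q),
        H.Noncommutative ∧ H.Noncocommutative ∧
        (∀ a, H.counit a = PowerSeries.map (counitU q).toRingHom a) ∧
        (∀ (y : Letter) (m : Fin 2 → ℤ) (r : ℂ), y ≠ Letter.e → y.Index m →
          r = ∑ i, x i * (m i : ℂ) →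
          H.comul (emb (y.elt q m)) =
            emb (y.elt q m) ⊠ pw E r + 1 ⊠ emb (y.elt q m)
              + beta q n m y •
                (emb T ⊠ pw E (-1) * emb (f q (m + n)) * X) ∧
          H.antipode (emb (y.elt q m)) =
            -(pw E (-r) * emb (y.elt q m))
              + beta q n m y • (pw E (-r) * emb (f q (m + n)) *
                rise (emb T) 1 1 * X)) ∧
        (∀ (m : Fin 2 → ℤ) (r : ℂ), m + n ≠ 0 → r = ∑ i, x i * (m i : ℂ) →
          H.comul (emb (e q m)) =
            qp q (m 1 * n 0) •
                (emb T ⊠ pw E (-1) * emb (g q (m + n)) * X)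
              - qp q (m 0 * n 1) •
                (emb T ⊠ pw E (-1) * emb (h q (m + n)) * X)
              + emb (e q m) ⊠ pw E r + 1 ⊠ emb (e q m)
              - sCoef q n m • (rise (emb T) 0 2 ⊠
                pw E (-2) * emb (f q (m + 2 • n)) * X ^ 2) ∧
          H.antipode (emb (e q m)) =
            qp q (m 1 * n 0) • (pw E (-r) * emb (g q (m + n)) *
                rise (emb T) 1 1 * X)
              - qp q (m 0 * n 1) • (pw E (-r) * emb (h q (m + n)) *
                rise (emb T) 1 1 * X)
              - pw E (-r) * emb (e q m)
              + sCoef q n m • (pw E (-r) * emb (f q (m + 2 • n)) *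
                rise (emb T) 1 2 * X ^ 2)) ∧
        H.comul (emb (e q (-n))) =
          emb (e q (-n)) ⊠ pw E (-1) + 1 ⊠ emb (e q (-n))
            + qp q (-(n 1 * n 0)) •
              (emb T ⊠ pw E (-1) * emb (d q) * X)
            - qp q (-(n 0 * n 1)) • (rise (emb T) 0 2 ⊠
              pw E (-2) * emb E * X ^ 2) ∧
        H.antipode (emb (e q (-n))) =
          qp q (-(n 0 * n 1)) • (pw E 1 * emb E *
              rise (emb T) 1 2 * X ^ 2)
            - pw E 1 * emb (e q (-n))
            + qp q (-(n 0 * n 1)) • (pw E 1 * emb (d q) *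
              rise (emb T) 1 1 * X) ∧
        H.comul (emb (d q)) =
          emb (d q) ⊠ 1 + 1 ⊠ emb (d q)
            - (2 : ℂ) • (emb T ⊠ pw E (-1) * emb E * X) ∧
        H.antipode (emb (d q)) =
          -emb (d q)
            - (2 : ℂ) • (emb E * rise (emb T) 1 1 * X) ∧
        (∀ i : Fin 2,
          H.comul (emb (dd q i)) =
            emb (dd q i) ⊠ 1 + 1 ⊠ emb (dd q i)
              - (n i : ℂ) • (emb T ⊠ 1) + (n i : ℂ) • (emb T ⊠ pw E (-1)) ∧
          H.antipode (emb (dd q i)) =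
            -emb (dd q i) + (n i : ℂ) • (emb T * emb E * X))) ∧
    -- `T = -d / 2`, `E = f_n`
    (∀ (n : Fin 2 → ℤ) (T E : ESL q),
      T = (-(1 / 2) : ℂ) • d q → E = f q n →
      ∃ H : FormalHopf ℂ (U q),
        H.Noncommutative ∧ H.Noncocommutative ∧
        (∀ a, H.counit a = PowerSeries.map (counitU q).toRingHom a) ∧
        (∀ (y : Letter) (m : Fin 2 → ℤ), y ≠ Letter.e → y.Index m →
          H.comul (emb (y.elt q m)) =
            emb (y.elt q m) ⊠ pw E (deltaF y) + 1 ⊠ emb (y.elt q m)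
              + beta q n m y •
                (emb T ⊠ pw E (-1) * emb (f q (m + n)) * X) ∧
          H.antipode (emb (y.elt q m)) =
            -(pw E (-deltaF y) * emb (y.elt q m))
              + beta q n m y • (emb (f q (m + n)) *
                rise (emb T) 1 1 * X)) ∧
        (∀ m : Fin 2 → ℤ, m + n ≠ 0 →
          H.comul (emb (e q m)) =
            qp q (m 1 * n 0) •
                (emb T ⊠ pw E (-1) * emb (g q (m + n)) * X)
              - qp q (m 0 * n 1) •
                (emb T ⊠ pw E (-1) * emb (h q (m + n)) * X)
              + emb (e q m) ⊠ pw E (-1) + 1 ⊠ emb (e q m)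
              - sCoef q n m • (rise (emb T) 0 2 ⊠
                pw E (-2) * emb (f q (m + 2 • n)) * X ^ 2) ∧
          H.antipode (emb (e q m)) =
            qp q (m 1 * n 0) • (pw E 1 * emb (g q (m + n)) *
                rise (emb T) 1 1 * X)
              - qp q (m 0 * n 1) • (pw E 1 * rise (emb T) 1 1 *
                emb (h q (m + n)) * X)
              - pw E 1 * emb (e q m)
              + sCoef q n m • (pw E 1 * emb (f q (m + 2 • n)) *
                rise (emb T) 1 2 * X ^ 2)) ∧
        H.comul (emb (e q (-n))) =
          emb (e q (-n)) ⊠ pw E (-1)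
            + qp q (-(n 1 * n 0)) •
              (emb T ⊠ pw E (-1) * emb (d q) * X)
            + 1 ⊠ emb (e q (-n))
            - qp q (-(n 0 * n 1)) • (rise (emb T) 0 2 ⊠
              pw E (-2) * emb E * X ^ 2) ∧
        H.antipode (emb (e q (-n))) =
          qp q (-(n 0 * n 1)) • (pw E 1 * emb E *
              rise (emb T) 1 2 * X ^ 2)
            - pw E 1 * emb (e q (-n))
            + qp q (-(n 0 * n 1)) • (pw E 1 * emb (d q) *
              rise (emb T) 1 1 * X) ∧
        H.comul (emb (d q)) =
          emb (d q) ⊠ 1 + 1 ⊠ emb (d q)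
            - (2 : ℂ) • (emb T ⊠ pw E (-1) * emb E * X) ∧
        H.antipode (emb (d q)) =
          -emb (d q)
            - (2 : ℂ) • (emb E * rise (emb T) 1 1 * X) ∧
        (∀ i : Fin 2,
          H.comul (emb (dd q i)) =
            emb (dd q i) ⊠ 1 + 1 ⊠ emb (dd q i)
              + (n i : ℂ) • (emb T ⊠ pw E (-1)) - (n i : ℂ) • (emb T ⊠ 1) ∧
          H.antipode (emb (dd q i)) =
            -emb (dd q i) + (n i : ℂ) • (emb T * emb E * X))) := by
  refine ⟨?_, ?_, ?_⟩
  · rintro n x _ _ hn rfl rfl hTE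
    have hT := lie_sum_dd_letter (q := q) x
    exact ⟨jordanianHopf hTE, jordanianHopf_noncommutative hTE (h_ne_zero hn),
      jordanianHopf_noncocommutative hTE (h_ne_zero hn), jordanianHopf_counit hTE,
      fun y m r _ hr => hr ▸ ⟨comul_letter_of_h hTE hn y m (hT y m),
        antipode_letter_of_h hTE hn y m (hT y m)⟩,
      fun i => comul_antipode_dd_of_letter (s := .h) hTE i rfl (lie_sum_dd_dd x i),
      comul_d_of_h hTE (lie_sum_dd_d x), antipode_d_of_h hTE (lie_sum_dd_d x)⟩
  · rintro n x _ _ rfl rfl hTE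
    have hT := lie_sum_dd_letter (q := q) x
    have hTe := lie_sum_dd_e_neg hTE
    exact ⟨jordanianHopf hTE, jordanianHopf_noncommutative hTE (f_ne_zero n),
      jordanianHopf_noncocommutative hTE (f_ne_zero n), jordanianHopf_counit hTE,
      fun y m r hy hm hr => hr ▸ ⟨comul_letter_of_f hTE hy hm (hT y m),
        antipode_letter_of_f hTE hy hm (hT y m)⟩,
      fun m r hm hr => hr ▸ ⟨comul_e_of_f hTE hm (hT .e m), antipode_e_of_f hTE hm (hT .e m)⟩,
      comul_e_neg_of_f hTE hTe, antipode_e_neg_of_f hTE hTe,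
      comul_emb_of_lie_eq_smul hTE (lie_sum_dd_d x) (lie_f_d n),
      antipode_emb_of_lie_eq_smul hTE (lie_sum_dd_d x) (lie_f_d n),
      fun i => comul_antipode_dd_of_letter (s := .f) hTE i rfl (lie_sum_dd_dd x i)⟩
  · rintro n _ _ rfl rfl
    have hTE := lie_half_d_f (q := q) n
    have hTe := lie_half_d_e (q := q)
    have dd_formulas (i : Fin 2) :=
      comul_antipode_dd_of_letter (s := .f) hTE i rfl (lie_half_d_dd i)
    exact ⟨jordanianHopf hTE, jordanianHopf_noncommutative hTE (f_ne_zero n),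
      jordanianHopf_noncocommutative hTE (f_ne_zero n), jordanianHopf_counit hTE,
      fun y m hy hm => ⟨comul_letter_of_f hTE hy hm (lie_half_d_letter hy m),
        antipode_letter_of_f_of_deltaF hTE hy hm (lie_half_d_letter hy m)⟩,
      fun m hm => ⟨comul_e_of_f hTE hm (hTe m),
        antipode_e_of_f_of_lie_h hTE hm (hTe m) (lie_half_d_h (m + n))⟩,
      (comul_e_neg_of_f hTE (hTe (-n))).trans (congrArg (· - _) (add_right_comm _ _ _)),
      antipode_e_neg_of_f hTE (hTe (-n)),
      comul_emb_of_lie_eq_smul hTE lie_half_d_d (lie_f_d n),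
      antipode_emb_of_lie_eq_smul hTE lie_half_d_d (lie_f_d n),
      fun i => (dd_formulas i).imp_left (·.trans (sub_add_eq_add_sub _ _ _))⟩
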